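/- **Programs.** Programs are the terms (up to renaming of bound variables) $$M,N,L,R ::= a \mid \lambda a.M \mid M\,N \mid M{\downarrow}N \mid \mathbf{rec}\,M \mid \bot \mid \mathbf{Nil} \mid \mathbf{Left}(M) \mid \mathbf{Right}(M) \mid \mathbf{Pair}(M,N) \mid \mathbf{Amb}(M,N)$$ $$\mid \mathbf{case}\,M\{\mathbf{Left}(a)\to L;\mathbf{Right}(b)\to R\} \mid \mathbf{case}\,M\{\mathbf{Pair}(a,b)\to N\} \mid \mathbf{case}\,M\{\mathbf{Amb}(a,b)\to N\},$$ where $M{\downarrow}N$ is strict application. $\mathbf{Nil},\mathbf{Left},\mathbf{Right},\mathbf{Pair}$ are the data constructors; the constructors are these and $\mathbf{Amb}$. **Semantics of programs.** $D$ is the Scott domain (canonical solution) of $D = (\mathbf{Nil}+\mathbf{Left}(D)+\mathbf{Right}(D)+\mathbf{Pair}(D\times D)+\mathbf{Amb}(D\times D)+\mathbf{Fun}(D\to D))_\bot$, with separated sum and continuous function space. The denotation $[\![M]\!]\eta\in D$ in an environment $\eta$ is given by: $[\![a]\!]\eta=\eta(a)$; $[\![\lambda a.M]\!]\eta=\mathbf{Fun}(d\mapsto[\![M]\!]\eta[a\mapsto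 d])$; $[\![M\,N]\!]\eta=f([\![N]\!]\eta)$ if $[\![M]\!]\eta=\mathbf{Fun}(f)$; $[\![M{\downarrow}N]\!]\eta=f([\![N]\!]\eta)$ if $[\![M]\!]\eta=\mathbf{Fun}(f)$ and $[\![N]\!]\eta\ne\bot$; $[\![\mathbf{rec}\,M]\!]\eta$ is the least fixed point of $f$ if $[\![M]\!]\eta=\mathbf{Fun}(f)$; constructors are interpreted by themselves ($\mathbf{Amb}$ as a mere pairing); $[\![\mathbf{case}\,M\{\ldots\}]\!]\eta=[\![K]\!]\eta[\vec a\mapsto\vec d]$ if $[\![M]\!]\eta=C(\vec d)$ and $C(\vec a)\to K$ is a clause; the denotation is $\bot$ in all other cases. For closed $M$ write $[\![M]\!]$. **Types.** Types are $\rho,\sigma ::= \alpha \mid \mathbf 1 \mid \rho\times\sigma \mid \rho+\sigma \mid \rho\Rightarrow\sigma \mid \mathbf{fix}\,\alpha.\rho \mid \mathbf A(\rho)$. A type is *determined* if it has the form $\mathbf{fix}\,\alpha_1\ldots\mathbf{fix}\,\alpha_n.\rho$ ($n\ge0$) with $\rho$ equal to $\mathbf 1$ or a product, sum or function type. It is *regular*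 if $\rho$ is determined for every subtype $\mathbf A(\rho)$, and for every subtype $\mathbf{fix}\,\alpha.\rho$ the variable $\alpha$ is free in $\rho$, $\rho\neq\alpha$, and $\alpha$ is not free in the left side of any function type in $\rho$. A subdomain is a subset of $D$ that is downward closed and closed under suprema of bounded subsets. For an assignment of subdomains to type variables, types denote subsets of $D$: $[\![\mathbf 1]\!]=\{\mathbf{Nil},\bot\}$; $[\![\rho\times\sigma]\!]$, $[\![\rho+\sigma]\!]$ consist of $\bot$ and the elements $\mathbf{Pair}(a,b)$, respectively $\mathbf{Left}(a)$, $\mathbf{Right}(b)$, with $a\in[\![\rho]\!]$, $b\in[\![\sigma]\!]$; $[\![\rho\Rightarrow\sigma]\!]$ consists of $\bot$ and all $\mathbf{Fun}(f)$ with $f$ continuous and $f([\![\rho]\!])\subseteq[\![\sigma]\!]$; $[\![\mathbf A(\rho)]\!]$ consists of $\bot$ and all $\mathbf{Amb}(a,b)$ with $a,b\in[\![\rho]\!]$; $[\![\mathbf{fix}\,\alpha.\rho]\!]$ is the intersection of all subdomains $X$ with $[\![\rho]\!][\alpha\mapsto X]\subseteq X$. The typing judgement $\Gamma\vdash M:\rho$,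 in which all types are regular, is given by the usual rules for variables, $\lambda$-abstraction, the two forms of application, the data constructors and the case constructs, together with: $\Gamma\vdash\bot:\rho$; $\mathbf{Amb}(M,N):\mathbf A(\rho)$ if $M,N:\rho$; $\mathbf{case}\,M\{\mathbf{Amb}(a,b)\to N\}:\tau$ if $M:\mathbf A(\rho)$ and $N:\tau$ for $a,b:\rho$; $\Gamma\vdash\mathbf{rec}\,M:\rho$ if $\Gamma,a:\rho\vdash M\,a:\rho$ with $a$ not free in $M$; and $M:\mathbf{fix}\,\alpha.\rho$ iff $M:\rho[\mathbf{fix}\,\alpha.\rho/\alpha]$. A closed program $M$ is *of regular type* if, for some closed regular type $\rho$, $\vdash M:\rho$ is derivable or $[\![M]\!]\in[\![\rho]\!]$. **Reduction** (of closed programs). A *weak head normal form* (w.h.n.f.) is a program that begins with a constructor or a $\lambda$; it is *deterministic* if it does not begin with $\mathbf{Amb}$. A program is *$\bot$-like* if it is $\bot$, $C(\vec M)\,N$, $C(\vec M){\downarrow}N$ ($C$ a constructor), or $\mathbf{case}\,M\{\ldots\}$ with $M$ a w.h.n.f. that matches no clause. The relation $\leadsto$ is generated by: $(\lambda a.M)\,N\leadsto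 M[N/a]$; $M\,N\leadsto M'\,N$ if $M\leadsto M'$; $(\lambda a.M){\downarrow}N\leadsto M[N/a]$ if $N$ is a w.h.n.f.; $M{\downarrow}N\leadsto M'{\downarrow}N$ if $M\leadsto M'$ and $N$ is a w.h.n.f.; $M{\downarrow}N\leadsto M{\downarrow}N'$ if $N\leadsto N'$; $\mathbf{rec}\,M\leadsto M\,(\mathbf{rec}\,M)$; $\mathbf{case}\,C(\vec M)\{\ldots;C(\vec b)\to N;\ldots\}\leadsto N[\vec M/\vec b]$; $\mathbf{case}\,M\{\ldots\}\leadsto\mathbf{case}\,M'\{\ldots\}$ if $M\leadsto M'$; $M\leadsto\bot$ if $M$ is $\bot$-like. The relation $\leadsto_c$ contains $\leadsto$ and is generated further by $\mathbf{Amb}(M_1,M_2)\leadsto_c\mathbf{Amb}(M_1',M_2)$ if $M_1\leadsto M_1'$, symmetrically for $M_2$, and $\mathbf{Amb}(M_1,M_2)\leadsto_c M_i$ if $M_i$ is a w.h.n.f. ($i=1,2$). The relation $\leadsto_p$ contains $\leadsto_c$ and is generated further by $C(M_1,\ldots,M_k)\leadsto_p C(M_1',\ldots,M_k')$ if $M_i\leadsto_p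 M_i'$ for all $i$ ($C$ a data constructor), and $\lambda a.M\leadsto_p\lambda a.M$. An infinite sequence $M_0\leadsto_p M_1\leadsto_p\cdots$ is *unfair* in the following inductively defined cases: every step reduces the left side of an $\mathbf{Amb}$ term only, that is, $M_i=\mathbf{Amb}(L_i,R)$ and $L_i\leadsto L_{i+1}$ for all $i$ with a fixed $R$, and for no $i$ is the step also a reduction of the right side, i.e. $L_i=L_{i+1}$ and $R\leadsto R$; or the same with the sides exchanged; or all $M_i$ begin with the same data constructor and, for some $k$, the sequence of their $k$-th arguments is unfair; or the tail $M_1\leadsto_p M_2\leadsto_p\cdots$ is unfair. A *computation* of $M$ is an infinite sequence $M=M_0\leadsto_p M_1\leadsto_p\cdots$ that is not unfair. $M$ is *productive* if in every computation of $M$ some $M_i$ is a deterministic w.h.n.f. **Corollary.** For a closed program $M$ of regular type, the following are equivalent: 1. $M$ is productive; 2. in some computation $M=M_0\leadsto_p M_1\leadsto_p\cdots$ some $M_i$ is a deterministic w.h.n.f.; 3. $[\![M]\!]$ is neither $\bot$ nor $\mathbf{Amb}(\bot,\bot)$. -/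

import Mathlib

namespace AmbCalc

/-! ## The Scott domain of the denotational semantics

`D` is the canonical solution (bilimit) of the domain equation
`D = (Nil + Left(D) + Right(D) + Pair(D × D) + Amb(D × D) + Fun(D → D))_⊥`,
presented as the inverse limit of the finite posets `F^n(1)`. -/

/-- The lifted separated sum on the right hand side of the domain equation, over a type `X` of
elements and a type `Y` of functions. -/
inductive Shape (X Y : Type) : Type
  | bot : Shape X Y
  | nil : Shape X Y
  | left (x : X) : Shape X Y
  | right (x : X) : Shape X Y
  | pair (x y : X) : Shape X Y
  | amb (x y : X) : Shape X Y
  | fn (f : Y) : Shape X Y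

namespace Shape

variable {X Y X' Y' : Type}

/-- The order of the lifted separated sum. -/
inductive Le [LE X] [LE Y] : Shape X Y → Shape X Y → Prop
  | bot (s : Shape X Y) : Le .bot s
  | nil : Le .nil .nil
  | left {x x' : X} : x ≤ x' → Le (.left x) (.left x')
  | right {x x' : X} : x ≤ x' → Le (.right x) (.right x')
  | pair {x x' y y' : X} : x ≤ x' → y ≤ y' → Le (.pair x y) (.pair x' y')
  | amb {x x' y y' : X} : x ≤ x' → y ≤ y' → Le (.amb x y) (.amb x' y')
  | fn {f f' : Y} : f ≤ f' → Le (.fn f) (.fn f')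

instance [PartialOrder X] [PartialOrder Y] : PartialOrder (Shape X Y) where
  le := Le
  le_refl s := by cases s <;> constructor <;> exact le_rfl
  le_trans a b c h₁ h₂ := by
    cases h₁ <;> cases h₂ <;> constructor <;> (apply le_trans <;> assumption)
  le_antisymm a b h₁ h₂ := by
    cases h₁ <;> cases h₂ <;> first | rfl | (congr 1 <;> (apply le_antisymm <;> assumption))

instance [PartialOrder X] [PartialOrder Y] : OrderBot (Shape X Y) where
  bot := .bot
  bot_le := Le.bot

/-- Functorial action. -/
def map (e : X → X') (h : Y → Y') : Shape X Y → Shape X' Y'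
  | .bot => .bot
  | .nil => .nil
  | .left x => .left (e x)
  | .right x => .right (e x)
  | .pair x y => .pair (e x) (e y)
  | .amb x y => .amb (e x) (e y)
  | .fn f => .fn (h f)

theorem map_mono [PartialOrder X] [PartialOrder Y] [PartialOrder X'] [PartialOrder Y']
    {e : X → X'} {h : Y → Y'} (he : Monotone e) (hh : Monotone h) : Monotone (map e h) := by
  intro a b hab
  cases hab with
  | bot s => exact Le.bot _
  | nil => exact Le.nil
  | left h => exact Le.left (he h)
  | right h => exact Le.right (he h)
  | pair h h' => exact Le.pair (he h) (he h')
  | amb h h' => exact Le.amb (he h) (he h')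
  | fn h => exact Le.fn (hh h)

end Shape

/-- A bundled poset with a least element. -/
structure Pointed where
  carrier : Type
  [order : PartialOrder carrier]
  [bot : OrderBot carrier]

/-- `F^n(1)`. All these posets are finite, so that on them a map is continuous iff it is monotone;
hence the function component uses monotone maps. -/
def approx : ℕ → Pointed
  | 0 => { carrier := Unit }
  | n + 1 =>
    letI := (approx n).order
    { carrier := Shape (approx n).carrier ((approx n).carrier →o (approx n).carrier) }

abbrev Approx (n : ℕ) : Type := (approx n).carrier

instance (n : ℕ) : PartialOrder (Approx n) := (approx n).order

instance (n : ℕ) : OrderBot (Approx n) := (approx n).bot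

/-- `F` on a pair of monotone maps `X → X'` and `X' → X`. -/
def liftHom {X X' : Type} [PartialOrder X] [PartialOrder X'] (e : X →o X') (p : X' →o X) :
    Shape X (X →o X) →o Shape X' (X' →o X') where
  toFun := Shape.map e (fun g => (e.comp g).comp p)
  monotone' := Shape.map_mono e.monotone (fun _ _ h x => e.monotone (h (p x)))

/-- The canonical maps `F^n(1) → F^m(1)` and `F^m(1) → F^n(1)`: the embedding and the projection
if `n ≤ m`, the projection and the embedding if `m ≤ n`. -/
def transPair : (n m : ℕ) → (Approx n →o Approx m) × (Approx m →o Approx n)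
  | 0, _ => (⊥, ⊥)
  | _ + 1, 0 => (⊥, ⊥)
  | n + 1, m + 1 =>
    (liftHom (transPair n m).1 (transPair n m).2, liftHom (transPair n m).2 (transPair n m).1)

/-- The canonical map `F^n(1) → F^m(1)`. -/
def trans (n m : ℕ) : Approx n →o Approx m := (transPair n m).1

theorem transPair_snd (n m : ℕ) : (transPair n m).2 = trans m n := by
  induction n generalizing m with
  | zero => cases m <;> rfl
  | succ n ih =>
    cases m with
    | zero => rfl
    | succ m =>
      have h : (transPair m n).2 = (transPair n m).1 := by
        have key : ∀ a b : ℕ, (transPair a b).swap = transPair b a := by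
          intro a
          induction a with
          | zero => intro b; cases b <;> rfl
          | succ a iha =>
            intro b
            cases b with
            | zero => rfl
            | succ b =>
              have := iha b
              simp only [transPair, Prod.swap, ← this]
        exact congrArg Prod.fst (key m n)
      have h' : (transPair n m).2 = (transPair m n).1 := ih m
      change liftHom (transPair n m).2 (transPair n m).1
        = liftHom (transPair m n).1 (transPair m n).2
      rw [h, h']

theorem trans_succ (n m : ℕ) : trans (n + 1) (m + 1) = liftHom (trans n m) (trans m n) := by
  change liftHom (transPair n m).1 (transPair n m).2 = _
  rw [transPair_snd]; rfl

theorem trans_zero (m : ℕ) (x : Approx 0) : trans 0 m x = ⊥ := rfl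

theorem trans_bot (n m : ℕ) : trans n m ⊥ = ⊥ := by
  cases n with
  | zero => rfl
  | succ n => cases m <;> rfl

theorem trans_trans (n m k : ℕ) (h : min n k ≤ m) (x : Approx n) :
    trans m k (trans n m x) = trans n k x := by
  induction m generalizing n k with
  | zero =>
    cases n with
    | zero => rfl
    | succ n =>
      cases k with
      | zero => rfl
      | succ k => omega
  | succ m ih =>
    cases n with
    | zero => rw [trans_zero, trans_zero, trans_bot]
    | succ n =>
      cases k with
      | zero => rfl
      | succ k =>
        have h₁ : ∀ y, trans m k (trans n m y) = trans n k y := ih n k (by omega)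
        have h₂ : ∀ y, trans m n (trans k m y) = trans k n y := ih k n (by omega)
        rw [trans_succ, trans_succ, trans_succ]
        change Shape.map _ _ (Shape.map _ _ x) = Shape.map _ _ x
        cases x with
        | bot => rfl
        | nil => rfl
        | left x => exact congrArg Shape.left (h₁ x)
        | right x => exact congrArg Shape.right (h₁ x)
        | pair x y => exact congrArg₂ Shape.pair (h₁ x) (h₁ y)
        | amb x y => exact congrArg₂ Shape.amb (h₁ x) (h₁ y)
        | fn f =>
          refine congrArg Shape.fn (OrderHom.ext _ _ (funext fun y => ?_))
          change trans m k (trans n m (f (trans m n (trans k m y)))) = trans n k (f (trans k n y))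
          rw [h₁, h₂]

/-- The domain `D`: the inverse limit of the `F^n(1)` along the projections, ordered
componentwise. -/
@[ext]
structure D : Type where
  coord : (n : ℕ) → Approx n
  compat : ∀ n, trans (n + 1) n (coord (n + 1)) = coord n

instance : PartialOrder D := PartialOrder.lift D.coord (fun _ _ h => D.ext h)

namespace D

/-- The embedding of `F^n(1)` into `D`. -/
def embed (n : ℕ) (x : Approx n) : D :=
  ⟨fun m => trans n m x, fun m => trans_trans n (m + 1) m (by omega) x⟩

theorem embed_mono (n : ℕ) : Monotone (embed n) :=
  fun _ _ h m => (trans n m).monotone h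

/-- The continuous functions `D → D`. -/
abbrev Cont : Type := {f : D → D // ScottContinuous f}

/-- The approximation of a continuous function by a function on `F^n(1)`. -/
def restrict (f : Cont) (n : ℕ) : Approx n →o Approx n where
  toFun x := (f.1 (embed n x)).coord n
  monotone' := fun _ _ h => f.2.monotone (embed_mono n h) n

/-- The isomorphism, from right to left, of the domain equation. -/
def fold (s : Shape D Cont) : D :=
  ⟨fun n => match n with
    | 0 => ⊥
    | n + 1 => (s.map (fun x => x.coord n) (fun f => restrict f n) :
        Shape (Approx n) (Approx n →o Approx n)),
   by
    intro n
    cases n with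
    | zero => rfl
    | succ n =>
      rw [trans_succ]
      change Shape.map _ _ (Shape.map _ _ s) = Shape.map _ _ s
      cases s with
      | bot => rfl
      | nil => rfl
      | left x => exact congrArg Shape.left (x.compat n)
      | right x => exact congrArg Shape.right (x.compat n)
      | pair x y => exact congrArg₂ Shape.pair (x.compat n) (y.compat n)
      | amb x y => exact congrArg₂ Shape.amb (x.compat n) (y.compat n)
      | fn f =>
        refine congrArg Shape.fn (OrderHom.ext _ _ (funext fun y => ?_))
        change trans (n + 1) n ((f.1 (embed (n + 1) (trans n (n + 1) y))).coord (n + 1))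
          = (f.1 (embed n y)).coord n
        have h : embed (n + 1) (trans n (n + 1) y) = embed n y :=
          D.ext (funext fun m => trans_trans n (n + 1) m (by omega) y)
        rw [h]
        exact (f.1 (embed n y)).compat n⟩

instance : Nonempty (Shape D Cont) := ⟨.bot⟩

/-- The isomorphism, from left to right, of the domain equation (the inverse of `fold`). -/
noncomputable def unfold : D → Shape D Cont := Function.invFun fold

/-- The least element of `D`. -/
def bot : D := fold .bot

def nil : D := fold .nil

def left (a : D) : D := fold (.left a)

def right (a : D) : D := fold (.right a)

def pair (a b : D) : D := fold (.pair a b)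

def amb (a b : D) : D := fold (.amb a b)

open Classical in
/-- `Fun(f)` for a continuous function `f` (and `⊥` for a discontinuous one; the semantics of
programs gives rise to continuous functions only). -/
noncomputable def fn (f : D → D) : D :=
  if h : ScottContinuous f then fold (.fn ⟨f, h⟩) else bot

open Classical in
/-- The least fixed point of `f` (it exists for every continuous `f`). -/
noncomputable def lfp (f : D → D) : D :=
  if h : ∃ a, IsLeast {a | f a = a} a then h.choose else bot

end D

/-! ## Programs -/

/-- Programs whose free variables are among `n` variables (de Bruijn indices). In the last two
case constructs the variable `a` of the clause `Pair(a,b) → N` or `Amb(a,b) → N` has index `0` and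
`b` has index `1`. -/
inductive Prog : ℕ → Type
  | var {n : ℕ} (i : Fin n) : Prog n
  | lam {n : ℕ} (M : Prog (n + 1)) : Prog n
  | app {n : ℕ} (M N : Prog n) : Prog n
  /-- strict application -/
  | sapp {n : ℕ} (M N : Prog n) : Prog n
  /-- recursion -/
  | fixp {n : ℕ} (M : Prog n) : Prog n
  | bot {n : ℕ} : Prog n
  | nil {n : ℕ} : Prog n
  | left {n : ℕ} (M : Prog n) : Prog n
  | right {n : ℕ} (M : Prog n) : Prog n
  | pair {n : ℕ} (M N : Prog n) : Prog n
  | amb {n : ℕ} (M N : Prog n) : Prog n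
  | caseSum {n : ℕ} (M : Prog n) (L R : Prog (n + 1)) : Prog n
  | casePair {n : ℕ} (M : Prog n) (N : Prog (n + 2)) : Prog n
  | caseAmb {n : ℕ} (M : Prog n) (N : Prog (n + 2)) : Prog n

/-- Extension of an environment, assigning `x` to index `0`. -/
def ext {A : Type} {n : ℕ} (x : A) (η : Fin n → A) : Fin (n + 1) → A := Fin.cons x η

namespace Prog

/-- A renaming under a binder. -/
def liftRen {n m : ℕ} (r : Fin n → Fin m) : Fin (n + 1) → Fin (m + 1) :=
  ext 0 (fun i => (r i).succ)

def rename : {n m : ℕ} → (Fin n → Fin m) → Prog n → Prog m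
  | _, _, r, var i => var (r i)
  | _, _, r, lam M => lam (M.rename (liftRen r))
  | _, _, r, app M N => app (M.rename r) (N.rename r)
  | _, _, r, sapp M N => sapp (M.rename r) (N.rename r)
  | _, _, r, fixp M => fixp (M.rename r)
  | _, _, _, bot => bot
  | _, _, _, nil => nil
  | _, _, r, left M => left (M.rename r)
  | _, _, r, right M => right (M.rename r)
  | _, _, r, pair M N => pair (M.rename r) (N.rename r)
  | _, _, r, amb M N => amb (M.rename r) (N.rename r)
  | _, _, r, caseSum M L R =>
    caseSum (M.rename r) (L.rename (liftRen r)) (R.rename (liftRen r))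
  | _, _, r, casePair M N => casePair (M.rename r) (N.rename (liftRen (liftRen r)))
  | _, _, r, caseAmb M N => caseAmb (M.rename r) (N.rename (liftRen (liftRen r)))

def weaken {n : ℕ} (M : Prog n) : Prog (n + 1) := M.rename Fin.succ

/-- A substitution under a binder. -/
def liftSub {n m : ℕ} (s : Fin n → Prog m) : Fin (n + 1) → Prog (m + 1) :=
  ext (var 0) (fun i => (s i).weaken)

/-- Simultaneous (capture avoiding) substitution. -/
def subst : {n m : ℕ} → (Fin n → Prog m) → Prog n → Prog m
  | _, _, s, var i => s i
  | _, _, s, lam M => lam (M.subst (liftSub s))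
  | _, _, s, app M N => app (M.subst s) (N.subst s)
  | _, _, s, sapp M N => sapp (M.subst s) (N.subst s)
  | _, _, s, fixp M => fixp (M.subst s)
  | _, _, _, bot => bot
  | _, _, _, nil => nil
  | _, _, s, left M => left (M.subst s)
  | _, _, s, right M => right (M.subst s)
  | _, _, s, pair M N => pair (M.subst s) (N.subst s)
  | _, _, s, amb M N => amb (M.subst s) (N.subst s)
  | _, _, s, caseSum M L R =>
    caseSum (M.subst s) (L.subst (liftSub s)) (R.subst (liftSub s))
  | _, _, s, casePair M N => casePair (M.subst s) (N.subst (liftSub (liftSub s)))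
  | _, _, s, caseAmb M N => caseAmb (M.subst s) (N.subst (liftSub (liftSub s)))

/-- `M[N/a]`. -/
def inst {n : ℕ} (M : Prog (n + 1)) (N : Prog n) : Prog n := M.subst (ext N var)

/-- `M[N₁/a, N₂/b]`. -/
def inst₂ {n : ℕ} (M : Prog (n + 2)) (N₁ N₂ : Prog n) : Prog n := M.subst (ext N₁ (ext N₂ var))

/-- The denotation of a program in an environment. -/
noncomputable def den : {n : ℕ} → Prog n → (Fin n → D) → D
  | _, var i, η => η i
  | _, lam M, η => D.fn (fun d => M.den (ext d η))
  | _, app M N, η =>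
    match (M.den η).unfold with
    | .fn f => f.1 (N.den η)
    | _ => D.bot
  | _, sapp M N, η =>
    match (M.den η).unfold, (N.den η).unfold with
    | .fn _, .bot => D.bot
    | .fn f, _ => f.1 (N.den η)
    | _, _ => D.bot
  | _, fixp M, η =>
    match (M.den η).unfold with
    | .fn f => D.lfp f.1
    | _ => D.bot
  | _, bot, _ => D.bot
  | _, nil, _ => D.nil
  | _, left M, η => D.left (M.den η)
  | _, right M, η => D.right (M.den η)
  | _, pair M N, η => D.pair (M.den η) (N.den η)
  | _, amb M N, η => D.amb (M.den η) (N.den η)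
  | _, caseSum M L R, η =>
    match (M.den η).unfold with
    | .left d => L.den (ext d η)
    | .right d => R.den (ext d η)
    | _ => D.bot
  | _, casePair M N, η =>
    match (M.den η).unfold with
    | .pair d e => N.den (ext d (ext e η))
    | _ => D.bot
  | _, caseAmb M N, η =>
    match (M.den η).unfold with
    | .amb d e => N.den (ext d (ext e η))
    | _ => D.bot

/-- The denotation of a closed program. -/
noncomputable def val (M : Prog 0) : D := M.den Fin.elim0

end Prog

/-! ## Types -/

/-- Types whose free variables are among `k` type variables (de Bruijn indices). -/
inductive Ty : ℕ → Type
  | var {k : ℕ} (i : Fin k) : Ty k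
  | one {k : ℕ} : Ty k
  | prod {k : ℕ} (ρ σ : Ty k) : Ty k
  | sum {k : ℕ} (ρ σ : Ty k) : Ty k
  | arrow {k : ℕ} (ρ σ : Ty k) : Ty k
  | fix {k : ℕ} (ρ : Ty (k + 1)) : Ty k
  /-- the type `A(ρ)` -/
  | am {k : ℕ} (ρ : Ty k) : Ty k

namespace Ty

/-- The type variable `i` occurs free. -/
def Free : {k : ℕ} → Fin k → Ty k → Prop
  | _, i, var j => i = j
  | _, _, one => False
  | _, i, prod ρ σ => ρ.Free i ∨ σ.Free i
  | _, i, sum ρ σ => ρ.Free i ∨ σ.Free i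
  | _, i, arrow ρ σ => ρ.Free i ∨ σ.Free i
  | _, i, fix ρ => ρ.Free i.succ
  | _, i, am ρ => ρ.Free i

/-- The type variable `i` does not occur free in the left side of a function type. -/
def StrictlyPos : {k : ℕ} → Fin k → Ty k → Prop
  | _, _, var _ => True
  | _, _, one => True
  | _, i, prod ρ σ => ρ.StrictlyPos i ∧ σ.StrictlyPos i
  | _, i, sum ρ σ => ρ.StrictlyPos i ∧ σ.StrictlyPos i
  | _, i, arrow ρ σ => ¬ ρ.Free i ∧ σ.StrictlyPos i
  | _, i, fix ρ => ρ.StrictlyPos i.succ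
  | _, i, am ρ => ρ.StrictlyPos i

/-- Properly strictly positive in the type variable `i`. -/
def ProperlyStrictlyPos {k : ℕ} (i : Fin k) (ρ : Ty k) : Prop :=
  ρ.Free i ∧ ρ ≠ var i ∧ ρ.StrictlyPos i

/-- `fix α₁. … fix αₙ. ρ` with `ρ` the unit type, a product, a sum or a function type. -/
def Determined : {k : ℕ} → Ty k → Prop
  | _, var _ => False
  | _, one => True
  | _, prod _ _ => True
  | _, sum _ _ => True
  | _, arrow _ _ => True
  | _, fix ρ => ρ.Determined
  | _, am _ => False

/-- For every subtype `A(ρ)`, `ρ` is determined, and for every subtype `fix α. ρ`, `ρ` is properly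
strictly positive in `α`. -/
def Regular : {k : ℕ} → Ty k → Prop
  | _, var _ => True
  | _, one => True
  | _, prod ρ σ => ρ.Regular ∧ σ.Regular
  | _, sum ρ σ => ρ.Regular ∧ σ.Regular
  | _, arrow ρ σ => ρ.Regular ∧ σ.Regular
  | _, fix ρ => ρ.ProperlyStrictlyPos 0 ∧ ρ.Regular
  | _, am ρ => ρ.Determined ∧ ρ.Regular

def rename : {k l : ℕ} → (Fin k → Fin l) → Ty k → Ty l
  | _, _, r, var i => var (r i)
  | _, _, _, one => one
  | _, _, r, prod ρ σ => prod (ρ.rename r) (σ.rename r)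
  | _, _, r, sum ρ σ => sum (ρ.rename r) (σ.rename r)
  | _, _, r, arrow ρ σ => arrow (ρ.rename r) (σ.rename r)
  | _, _, r, fix ρ => fix (ρ.rename (ext 0 (fun i => (r i).succ)))
  | _, _, r, am ρ => am (ρ.rename r)

def subst : {k l : ℕ} → (Fin k → Ty l) → Ty k → Ty l
  | _, _, s, var i => s i
  | _, _, _, one => one
  | _, _, s, prod ρ σ => prod (ρ.subst s) (σ.subst s)
  | _, _, s, sum ρ σ => sum (ρ.subst s) (σ.subst s)
  | _, _, s, arrow ρ σ => arrow (ρ.subst s) (σ.subst s)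
  | _, _, s, fix ρ => fix (ρ.subst (ext (var 0) (fun i => (s i).rename Fin.succ)))
  | _, _, s, am ρ => am (ρ.subst s)

/-- `ρ[σ/α]`. -/
def inst {k : ℕ} (ρ : Ty (k + 1)) (σ : Ty k) : Ty k := ρ.subst (ext σ var)

/-- Subdomains: downward closed subsets of `D` that are closed under suprema of bounded subsets
(a set with a supremum is bounded, and bounded subsets of `D` have suprema). -/
def IsSubdomain (X : Set D) : Prop :=
  IsLowerSet X ∧ ∀ S ⊆ X, ∀ a, IsLUB S a → a ∈ X

/-- The denotation of a type in an environment assigning subsets of `D` (in all uses below: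
subdomains) to the type variables. -/
def den : {k : ℕ} → Ty k → (Fin k → Set D) → Set D
  | _, var i, ζ => ζ i
  | _, one, _ => {D.nil, D.bot}
  | _, prod ρ σ, ζ => {x | ∃ a ∈ ρ.den ζ, ∃ b ∈ σ.den ζ, x = D.pair a b} ∪ {D.bot}
  | _, sum ρ σ, ζ =>
    {x | ∃ a ∈ ρ.den ζ, x = D.left a} ∪ {x | ∃ b ∈ σ.den ζ, x = D.right b} ∪ {D.bot}
  | _, arrow ρ σ, ζ =>
    {x | ∃ f : D → D, ScottContinuous f ∧ (∀ a ∈ ρ.den ζ, f a ∈ σ.den ζ) ∧ x = D.fn f} ∪ {D.bot}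
  | _, fix ρ, ζ => ⋂₀ {X | IsSubdomain X ∧ ρ.den (ext X ζ) ⊆ X}
  | _, am ρ, ζ => {x | ∃ a ∈ ρ.den ζ, ∃ b ∈ ρ.den ζ, x = D.amb a b} ∪ {D.bot}

/-- The denotation of a closed type. -/
def val (ρ : Ty 0) : Set D := ρ.den Fin.elim0

end Ty

/-- Derivability `Γ ⊢ M : ρ` in the typing system. The side conditions say that only regular types
are used: if the types in `Γ` are regular, then so are all types in a derivation. -/
inductive Typing {k : ℕ} : {n : ℕ} → (Fin n → Ty k) → Prog n → Ty k → Prop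
  | var {n : ℕ} {Γ : Fin n → Ty k} (i : Fin n) : Typing Γ (.var i) (Γ i)
  | nil {n : ℕ} {Γ : Fin n → Ty k} : Typing Γ .nil .one
  | bot {n : ℕ} {Γ : Fin n → Ty k} {ρ : Ty k} : ρ.Regular → Typing Γ .bot ρ
  | left {n : ℕ} {Γ : Fin n → Ty k} {M : Prog n} {ρ σ : Ty k} :
      σ.Regular → Typing Γ M ρ → Typing Γ (.left M) (.sum ρ σ)
  | right {n : ℕ} {Γ : Fin n → Ty k} {M : Prog n} {ρ σ : Ty k} :
      ρ.Regular → Typing Γ M σ → Typing Γ (.right M) (.sum ρ σ)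
  | pair {n : ℕ} {Γ : Fin n → Ty k} {M N : Prog n} {ρ σ : Ty k} :
      Typing Γ M ρ → Typing Γ N σ → Typing Γ (.pair M N) (.prod ρ σ)
  | amb {n : ℕ} {Γ : Fin n → Ty k} {M N : Prog n} {ρ : Ty k} :
      (Ty.am ρ).Regular → Typing Γ M ρ → Typing Γ N ρ → Typing Γ (.amb M N) (.am ρ)
  | lam {n : ℕ} {Γ : Fin n → Ty k} {M : Prog (n + 1)} {ρ σ : Ty k} :
      ρ.Regular → Typing (ext ρ Γ) M σ → Typing Γ (.lam M) (.arrow ρ σ)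
  | fixp {n : ℕ} {Γ : Fin n → Ty k} {M : Prog n} {ρ : Ty k} :
      ρ.Regular → Typing (ext ρ Γ) (.app M.weaken (.var 0)) ρ → Typing Γ (.fixp M) ρ
  | app {n : ℕ} {Γ : Fin n → Ty k} {M N : Prog n} {ρ σ : Ty k} :
      Typing Γ M (.arrow ρ σ) → Typing Γ N ρ → Typing Γ (.app M N) σ
  | sapp {n : ℕ} {Γ : Fin n → Ty k} {M N : Prog n} {ρ σ : Ty k} :
      Typing Γ M (.arrow ρ σ) → Typing Γ N ρ → Typing Γ (.sapp M N) σ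
  | roll {n : ℕ} {Γ : Fin n → Ty k} {M : Prog n} {ρ : Ty (k + 1)} :
      (Ty.fix ρ).Regular → Typing Γ M (ρ.inst (.fix ρ)) → Typing Γ M (.fix ρ)
  | unroll {n : ℕ} {Γ : Fin n → Ty k} {M : Prog n} {ρ : Ty (k + 1)} :
      Typing Γ M (.fix ρ) → Typing Γ M (ρ.inst (.fix ρ))
  | caseSum {n : ℕ} {Γ : Fin n → Ty k} {M : Prog n} {L R : Prog (n + 1)} {ρ σ τ : Ty k} :
      Typing Γ M (.sum ρ σ) → Typing (ext ρ Γ) L τ → Typing (ext σ Γ) R τ →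
        Typing Γ (.caseSum M L R) τ
  | casePair {n : ℕ} {Γ : Fin n → Ty k} {M : Prog n} {N : Prog (n + 2)} {ρ σ τ : Ty k} :
      Typing Γ M (.prod ρ σ) → Typing (ext ρ (ext σ Γ)) N τ → Typing Γ (.casePair M N) τ
  | caseAmb {n : ℕ} {Γ : Fin n → Ty k} {M : Prog n} {N : Prog (n + 2)} {ρ τ : Ty k} :
      Typing Γ M (.am ρ) → Typing (ext ρ (ext ρ Γ)) N τ → Typing Γ (.caseAmb M N) τ

namespace Prog

/-- The closed program `M` is of regular type: for some closed regular type `ρ`, the typing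
`⊢ M : ρ` is derivable, or the denotation of `M` is a member of the denotation of `ρ`. -/
def HasRegularType (M : Prog 0) : Prop :=
  ∃ ρ : Ty 0, ρ.Regular ∧ (Typing Fin.elim0 M ρ ∨ M.val ∈ ρ.val)

/-! ## Operational semantics -/

/-- `M` begins with a data constructor. -/
def IsData {n : ℕ} : Prog n → Prop
  | nil | left _ | right _ | pair _ _ => True
  | _ => False

/-- `M` begins with a constructor (including `Amb`). -/
def IsCon {n : ℕ} (M : Prog n) : Prop := M.IsData ∨ ∃ L R, M = amb L R

def IsLam {n : ℕ} (M : Prog n) : Prop := ∃ N, M = lam N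

/-- Weak head normal forms. -/
def Whnf {n : ℕ} (M : Prog n) : Prop := M.IsCon ∨ M.IsLam

/-- Deterministic weak head normal forms: those that do not begin with `Amb`. -/
def DWhnf {n : ℕ} (M : Prog n) : Prop := M.Whnf ∧ ¬ ∃ L R, M = amb L R

/-- Programs whose form immediately implies that they denote `⊥`. -/
inductive BotLike : Prog 0 → Prop
  | bot : BotLike bot
  | app {M N : Prog 0} : M.IsCon → BotLike (app M N)
  | sapp {M N : Prog 0} : M.IsCon → BotLike (sapp M N)
  | caseSum {M : Prog 0} {L R : Prog 1} :
      M.Whnf → (∀ N, M ≠ left N) → (∀ N, M ≠ right N) → BotLike (caseSum M L R)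
  | casePair {M : Prog 0} {N : Prog 2} :
      M.Whnf → (∀ L R, M ≠ pair L R) → BotLike (casePair M N)
  | caseAmb {M : Prog 0} {N : Prog 2} :
      M.Whnf → (∀ L R, M ≠ amb L R) → BotLike (caseAmb M N)

/-- Small-step leftmost-outermost reduction. -/
inductive Step : Prog 0 → Prog 0 → Prop
  | beta {M : Prog 1} {N : Prog 0} : Step (app (lam M) N) (M.inst N)
  | app {M M' N : Prog 0} : Step M M' → Step (app M N) (app M' N)
  | sbeta {M : Prog 1} {N : Prog 0} : N.Whnf → Step (sapp (lam M) N) (M.inst N)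
  | sappFun {M M' N : Prog 0} : N.Whnf → Step M M' → Step (sapp M N) (sapp M' N)
  | sappArg {M N N' : Prog 0} : Step N N' → Step (sapp M N) (sapp M N')
  | fixp {M : Prog 0} : Step (fixp M) (.app M (.fixp M))
  | caseLeft {M : Prog 0} {L R : Prog 1} : Step (caseSum (left M) L R) (L.inst M)
  | caseRight {M : Prog 0} {L R : Prog 1} : Step (caseSum (right M) L R) (R.inst M)
  | casePair {M₁ M₂ : Prog 0} {N : Prog 2} : Step (casePair (pair M₁ M₂) N) (N.inst₂ M₁ M₂)
  | caseAmb {M₁ M₂ : Prog 0} {N : Prog 2} : Step (caseAmb (amb M₁ M₂) N) (N.inst₂ M₁ M₂)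
  | caseSumArg {M M' : Prog 0} {L R : Prog 1} :
      Step M M' → Step (caseSum M L R) (caseSum M' L R)
  | casePairArg {M M' : Prog 0} {N : Prog 2} : Step M M' → Step (.casePair M N) (.casePair M' N)
  | caseAmbArg {M M' : Prog 0} {N : Prog 2} : Step M M' → Step (.caseAmb M N) (.caseAmb M' N)
  | botLike {M : Prog 0} : M.BotLike → Step M bot

/-- Reduction with choices. -/
inductive CStep : Prog 0 → Prog 0 → Prop
  | step {M M' : Prog 0} : Step M M' → CStep M M'
  | ambLeft {M₁ M₁' M₂ : Prog 0} : Step M₁ M₁' → CStep (amb M₁ M₂) (amb M₁' M₂)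
  | ambRight {M₁ M₂ M₂' : Prog 0} : Step M₂ M₂' → CStep (amb M₁ M₂) (amb M₁ M₂')
  | chooseLeft {M₁ M₂ : Prog 0} : M₁.Whnf → CStep (amb M₁ M₂) M₁
  | chooseRight {M₁ M₂ : Prog 0} : M₂.Whnf → CStep (amb M₁ M₂) M₂

/-- Reduction with choices and with parallel reduction of the arguments of data constructors. -/
inductive PStep : Prog 0 → Prog 0 → Prop
  | cstep {M M' : Prog 0} : CStep M M' → PStep M M'
  | nil : PStep nil nil
  | left {M M' : Prog 0} : PStep M M' → PStep (left M) (left M')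
  | right {M M' : Prog 0} : PStep M M' → PStep (right M) (right M')
  | pair {M M' N N' : Prog 0} : PStep M M' → PStep N N' → PStep (pair M N) (pair M' N')
  | lam {M : Prog 1} : PStep (lam M) (lam M)

/-- `M = Amb(L,R)` and `M' = Amb(L',R)` where `L` reduces to `L'` in one step. -/
def ReducesLeft (M M' : Prog 0) : Prop :=
  ∃ L L' R, M = amb L R ∧ M' = amb L' R ∧ Step L L'

/-- `M = Amb(L,R)` and `M' = Amb(L,R')` where `R` reduces to `R'` in one step. -/
def ReducesRight (M M' : Prog 0) : Prop :=
  ∃ L R R', M = amb L R ∧ M' = amb L R' ∧ Step R R'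

/-- Unfair reduction sequences: from some point on, one side of an `Amb` term is permanently
reduced but not the other. A step such as `Amb(⊥,⊥) → Amb(⊥,⊥)`, which is a reduction of the left
side as well as of the right side, is not a reduction of one side only. -/
inductive Unfair : (ℕ → Prog 0) → Prop
  | ambLeft {s : ℕ → Prog 0} :
      (∀ i, ReducesLeft (s i) (s (i + 1)) ∧ ¬ ReducesRight (s i) (s (i + 1))) → Unfair s
  | ambRight {s : ℕ → Prog 0} :
      (∀ i, ReducesRight (s i) (s (i + 1)) ∧ ¬ ReducesLeft (s i) (s (i + 1))) → Unfair s
  | left {s t : ℕ → Prog 0} : (∀ i, s i = left (t i)) → Unfair t → Unfair s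
  | right {s t : ℕ → Prog 0} : (∀ i, s i = right (t i)) → Unfair t → Unfair s
  | pairFst {s t u : ℕ → Prog 0} : (∀ i, s i = pair (t i) (u i)) → Unfair t → Unfair s
  | pairSnd {s t u : ℕ → Prog 0} : (∀ i, s i = pair (t i) (u i)) → Unfair u → Unfair s
  | tail {s : ℕ → Prog 0} : Unfair (fun i => s (i + 1)) → Unfair s

/-- The sequence `s` is a computation of `M`: an infinite fair reduction sequence from `M`. -/
def IsComputation (M : Prog 0) (s : ℕ → Prog 0) : Prop :=
  s 0 = M ∧ (∀ i, PStep (s i) (s (i + 1))) ∧ ¬ Unfair s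

/-- Every computation of `M` produces a deterministic weak head normal form. -/
def Productive (M : Prog 0) : Prop :=
  ∀ s, IsComputation M s → ∃ i, (s i).DWhnf

end Prog

end AmbCalc

/-! ### Truncations, directed suprema and Scott continuity in the inverse limit -/

namespace AmbCalc

namespace Shape

variable {X Y : Type}

/-! Let `M` be the program. A productive program meets condition 2 because a computation always
exists: alternate between the two sides of every `Amb`, and take a side as soon as it is a weak head
normal form (`exists_isComputation`).

Condition 2 implies 3 because a deterministic weak head normal form denotes neither `⊥` nor
`Amb(⊥,⊥)`, while a program denoting one of these two keeps denoting one of them under every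
reduction step (`PStep.val_eq_bot_or`). This rests on the soundness of reduction, `Step.val_eq`.
Neither argument needs the type.

For 3 implies 1, computational adequacy (`exists_red`) says that a program not denoting `⊥` reduces
to a weak head normal form; reduction is deterministic on such programs (`Step.eq_next`), so it
terminates on them (`acc_step`). Hence every computation of `M` reaches a weak head normal form. If
that is `Amb(L,R)`, then `L` or `R` does not denote `⊥`. That side can be reduced only finitely
often, so if no choice were ever made, only the other side would be reduced from some point on,
which is unfair. The side that is chosen must not be an `Amb` again: `Amb(Amb(⊥,⊥),⊥)` satisfies 3
but is not productive. Regularity excludes this, since the type under `A` is determined and its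
elements are never of the form `Amb(a,b)` (`HasRegularType.not_isAmb`).

Adequacy and soundness of typing both need a relation between `D` and syntactic codes that is
recursive with codes in negative position in the function clause, so it is not an inductive
definition. A `Frame` handles both at once: the relation is defined by recursion on the finite
approximations of `D`, and the expected clauses are recovered in the limit by continuity
(`Frame.rel_fn`, `Frame.rel_lfp`). All continuity arguments are statements about truncations to
finite levels. Typable programs are treated with the frame that unfolds `fix`; programs whose
denotation merely lies in a type are treated directly with the intersection that interprets `fix`.
-/

instance [Finite X] [Finite Y] : Finite (Shape X Y) := by
  let g : Shape X Y → Fin 7 × Option X × Option X × Option Y := fun s => match s with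
    | .bot => (0, none, none, none)
    | .nil => (1, none, none, none)
    | .left x => (2, some x, none, none)
    | .right x => (3, some x, none, none)
    | .pair x y => (4, some x, some y, none)
    | .amb x y => (5, some x, some y, none)
    | .fn f => (6, none, none, some f)
  refine Finite.of_injective g fun s t h => ?_
  cases s <;> cases t <;> simp_all [g]

end Shape

instance (n : ℕ) : Finite (Approx n) := by
  induction n with
  | zero => exact inferInstanceAs (Finite Unit)
  | succ n ih =>
    have : Finite (Approx n →o Approx n) := DFunLike.finite _
    exact inferInstanceAs (Finite (Shape (Approx n) (Approx n →o Approx n)))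

/-- A detour through a small level `m` can only lose information. In the function case the argument
is transported in the opposite direction, so the induction hypothesis is used for `(n, k)` and for
`(k, n)`. -/
theorem trans_trans_le (n m k : ℕ) (x : Approx n) : trans m k (trans n m x) ≤ trans n k x := by
  induction m generalizing n k with
  | zero =>
    rw [trans_zero]
    exact bot_le
  | succ m ih =>
    cases n with
    | zero => rw [trans_zero, trans_zero, trans_bot]
    | succ n =>
      cases k with
      | zero => exact le_rfl
      | succ k =>
        rw [trans_succ, trans_succ, trans_succ]
        change Shape.Le (Shape.map _ _ (Shape.map _ _ x)) (Shape.map _ _ x)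
        cases x with
        | bot => exact .bot _
        | nil => exact .nil
        | left x => exact .left (ih n k x)
        | right x => exact .right (ih n k x)
        | pair x y => exact .pair (ih n k x) (ih n k y)
        | amb x y => exact .amb (ih n k x) (ih n k y)
        | fn f =>
          refine .fn fun y => ?_
          change trans m k (trans n m (f (trans m n (trans k m y)))) ≤ trans n k (f (trans k n y))
          exact (ih n k _).trans ((trans n k).monotone (f.monotone (ih k n y)))

theorem trans_self (n : ℕ) (x : Approx n) : trans n n x = x := by
  induction n with
  | zero => rfl
  | succ n ih =>
    rw [trans_succ]
    change Shape.map _ _ x = x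
    cases x with
    | bot => rfl
    | nil => rfl
    | left x => exact congrArg Shape.left (ih x)
    | right x => exact congrArg Shape.right (ih x)
    | pair x y => exact congrArg₂ Shape.pair (ih x) (ih y)
    | amb x y => exact congrArg₂ Shape.amb (ih x) (ih y)
    | fn f =>
      refine congrArg Shape.fn (OrderHom.ext _ _ (funext fun y => ?_))
      change trans n n (f (trans n n y)) = f y
      rw [ih, ih]

namespace D

theorem trans_coord (d : D) {n m : ℕ} (h : n ≤ m) : trans m n (d.coord m) = d.coord n := by
  induction m, h using Nat.le_induction with
  | base => exact trans_self _ _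
  | succ m h ih => rw [← trans_trans (m + 1) m n (by omega), d.compat, ih]

/-- The largest element below `d` that comes from `F^m(1)`. -/
def trunc (m : ℕ) (d : D) : D := embed m (d.coord m)

theorem coord_trunc (m k : ℕ) (d : D) : (trunc m d).coord k = trans m k (d.coord m) := rfl

theorem coord_trunc_of_le {m k : ℕ} (h : k ≤ m) (d : D) : (trunc m d).coord k = d.coord k :=
  trans_coord d h

theorem trunc_le (m : ℕ) (d : D) : trunc m d ≤ d := by
  intro k
  rcases le_total k m with h | h
  · exact (coord_trunc_of_le h d).le
  · rw [coord_trunc, ← trans_coord d h]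
    exact (trans_trans_le k m k _).trans (trans_self k _).le

theorem trunc_mono (m : ℕ) : Monotone (trunc m) := fun _ _ h => embed_mono m (h m)

theorem trunc_trunc {m k : ℕ} (h : m ≤ k) (d : D) : trunc m (trunc k d) = trunc m d :=
  congrArg (embed m) (coord_trunc_of_le h d)

theorem trunc_le_trunc {m k : ℕ} (h : m ≤ k) (d : D) : trunc m d ≤ trunc k d := by
  rw [← trunc_trunc h]
  exact trunc_le _ _

theorem trunc_le_of_coord_le {m : ℕ} {d e : D} (h : d.coord m ≤ e.coord m) : trunc m d ≤ e :=
  (embed_mono m h).trans (trunc_le m e)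

/-- The `n`-th coordinates form a finite set, and in a directed set a maximal coordinate is the
largest one. -/
theorem exists_coord_max {S : Set D} (hne : S.Nonempty) (hd : DirectedOn (· ≤ ·) S) (n : ℕ) :
    ∃ x ∈ S, ∀ y ∈ S, y.coord n ≤ x.coord n := by
  obtain ⟨_, ⟨x, hx, rfl⟩, hmax⟩ :=
    (Set.toFinite ((fun x : D => x.coord n) '' S)).exists_maximal (hne.image _)
  refine ⟨x, hx, fun y hy => ?_⟩
  obtain ⟨z, hz, hxz, hyz⟩ := hd x hx y hy
  exact (hyz n).trans (hmax ⟨z, hz, rfl⟩ (hxz n))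

/-- The supremum is taken coordinatewise. That each of its coordinates is attained in `S` takes the
place of compactness of the finite elements. -/
theorem exists_isLUB {S : Set D} (hne : S.Nonempty) (hd : DirectedOn (· ≤ ·) S) :
    ∃ a, IsLUB S a ∧ ∀ n, ∃ x ∈ S, a.coord n = x.coord n := by
  choose x hx hmax using exists_coord_max hne hd
  refine ⟨⟨fun n => (x n).coord n, fun n => ?_⟩, ⟨fun y hy n => hmax n y hy, fun b hb n => ?_⟩,
    fun n => ⟨x n, hx n, rfl⟩⟩
  · rw [(x (n + 1)).compat]
    refine le_antisymm (hmax n _ (hx _)) ?_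
    rw [← (x n).compat, ← (x (n + 1)).compat]
    exact (trans (n + 1) n).monotone (hmax (n + 1) _ (hx n))
  · exact hb (hx n) n

theorem coord_isLUB {S : Set D} (hne : S.Nonempty) (hd : DirectedOn (· ≤ ·) S) {a : D}
    (ha : IsLUB S a) (n : ℕ) : ∃ x ∈ S, a.coord n = x.coord n := by
  obtain ⟨b, hb, h⟩ := exists_isLUB hne hd
  rw [ha.unique hb]
  exact h n

theorem directedOn_range {c : ℕ → D} (hc : Monotone c) : DirectedOn (· ≤ ·) (Set.range c) := by
  rintro _ ⟨i, rfl⟩ _ ⟨j, rfl⟩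
  exact ⟨_, ⟨max i j, rfl⟩, hc (le_max_left _ _), hc (le_max_right _ _)⟩

theorem exists_isLUB_range {c : ℕ → D} (hc : Monotone c) :
    ∃ a, IsLUB (Set.range c) a ∧ ∀ n, ∃ N, ∀ m ≥ N, a.coord n = (c m).coord n := by
  obtain ⟨a, ha, h⟩ := exists_isLUB (Set.range_nonempty c) (directedOn_range hc)
  refine ⟨a, ha, fun n => ?_⟩
  obtain ⟨_, ⟨N, rfl⟩, hN⟩ := h n
  exact ⟨N, fun m hm => le_antisymm (hN.le.trans (hc hm n)) (ha.1 ⟨m, rfl⟩ n)⟩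

theorem isLUB_trunc (x : D) : IsLUB (Set.range fun m => trunc m x) x := by
  refine ⟨?_, fun b hb n => ?_⟩
  · rintro _ ⟨m, rfl⟩
    exact trunc_le m x
  · rw [← coord_trunc_of_le le_rfl x]
    exact hb ⟨n, rfl⟩ n

/-- Every element is the directed supremum of its truncations, and coordinates of directed suprema
are attained. Continuity thus becomes an ε-δ condition: each coordinate of the value is already
reached on some truncation of the argument. -/
theorem scottContinuous_iff {f : D → D} :
    ScottContinuous f ↔ Monotone f ∧ ∀ x k, ∃ m, (f x).coord k ≤ (f (trunc m x)).coord k := by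
  constructor
  · intro hf
    refine ⟨hf.monotone, fun x k => ?_⟩
    have hd := directedOn_range (c := fun m => trunc m x) fun _ _ h => trunc_le_trunc h x
    have hl := hf (Set.range_nonempty _) hd (isLUB_trunc x)
    rw [← Set.range_comp] at hl
    obtain ⟨_, ⟨m, rfl⟩, h⟩ := coord_isLUB (Set.range_nonempty _)
      (directedOn_range fun _ _ h => hf.monotone (trunc_le_trunc h x)) hl k
    exact ⟨m, h.le⟩
  · rintro ⟨hm, hf⟩ S hne hd a ha
    refine ⟨?_, fun b hb k => ?_⟩
    · rintro _ ⟨x, hx, rfl⟩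
      exact hm (ha.1 hx)
    · obtain ⟨m, h⟩ := hf a k
      obtain ⟨x, hx, e⟩ := coord_isLUB hne hd ha m
      refine h.trans ((hm (trunc_le_of_coord_le e.le) k).trans (hb ⟨x, hx, rfl⟩ k))

theorem Cont.exists_le (f : Cont) (x : D) (k : ℕ) :
    ∃ m, k ≤ m ∧ (f.1 x).coord k ≤ (f.1 (trunc m x)).coord k := by
  obtain ⟨m, h⟩ := (scottContinuous_iff.1 f.2).2 x k
  exact ⟨max m k, le_max_right _ _,
    h.trans (f.2.monotone (trunc_le_trunc (le_max_left _ _) x) k)⟩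

theorem coord_apply_trunc (f : Cont) {m k : ℕ} (h : k ≤ m) (x : D) :
    (f.1 (trunc m x)).coord k = trans m k (restrict f m (x.coord m)) :=
  (trans_coord _ h).symm

theorem Cont.le_of_restrict_le {f g : Cont} (h : ∀ n, restrict f n ≤ restrict g n) : f ≤ g := by
  intro x k
  obtain ⟨m, hkm, hm⟩ := f.exists_le x k
  refine hm.trans ?_
  rw [coord_apply_trunc f hkm]
  refine ((trans m k).monotone (h m _)).trans ?_
  rw [← coord_apply_trunc g hkm]
  exact g.2.monotone (trunc_le m x) k

/-! ### The domain equation -/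

theorem fold_le_iff {s t : Shape D Cont} : fold s ≤ fold t ↔ s ≤ t := by
  constructor
  · intro h
    have h' : ∀ n, Shape.Le (s.map (fun x => x.coord n) (fun f => restrict f n))
      (t.map (fun x => x.coord n) (fun f => restrict f n)) := fun n => h (n + 1)
    change Shape.Le s t
    -- Coordinate `1` already shows the outermost constructor, which rules out all mismatched pairs.
    have h0 := h' 0
    cases s with
    | bot => exact .bot _
    | nil => cases t <;> first | exact .nil | cases h0
    | left x =>
      cases t <;> first | exact .left fun n => by cases h' n; assumption | cases h0
    | right x =>
      cases t <;> first | exact .right fun n => by cases h' n; assumption | cases h0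
    | pair x y =>
      cases t <;> first
        | exact .pair (fun n => by cases h' n; assumption) (fun n => by cases h' n; assumption)
        | cases h0
    | amb x y =>
      cases t <;> first
        | exact .amb (fun n => by cases h' n; assumption) (fun n => by cases h' n; assumption)
        | cases h0
    | fn f =>
      cases t <;> first
        | exact .fn (Cont.le_of_restrict_le fun n => by cases h' n; assumption)
        | cases h0
  · intro h n
    cases n with
    | zero => exact le_rfl
    | succ n =>
      have h₁ : Monotone fun x : D => x.coord n := fun _ _ h => h n
      have h₂ : Monotone fun f : Cont => restrict f n := fun _ _ h x => h _ n
      exact Shape.map_mono h₁ h₂ h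

theorem fold_injective : Function.Injective fold := fun _ _ h =>
  le_antisymm (fold_le_iff.1 h.le) (fold_le_iff.1 h.ge)

/-- A coherent sequence of functions on the finite approximations comes from a continuous
function. -/
theorem exists_cont (f : ∀ n, Approx n →o Approx n)
    (hf : ∀ n x, trans (n + 1) n (f (n + 1) (trans n (n + 1) x)) = f n x) :
    ∃ g : Cont, ∀ n, restrict g n = f n := by
  have hf' : ∀ n N, n ≤ N → ∀ x, trans N n (f N (trans n N x)) = f n x := by
    intro n N h
    induction N, h using Nat.le_induction with
    | base => intro x; rw [trans_self, trans_self]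
    | succ N h ih =>
      intro x
      rw [← trans_trans (N + 1) N n (by omega), ← trans_trans n N (N + 1) (by omega), hf, ih]
  -- The value of the function sought at `x` is the supremum of this chain.
  let c : D → ℕ → D := fun x n => embed n (f n (x.coord n))
  have hc : ∀ x, Monotone (c x) := by
    intro x
    refine monotone_nat_of_le_succ fun n => ?_
    intro k
    change trans n k _ ≤ trans (n + 1) k _
    rw [← hf n]
    refine (trans_trans_le _ _ _ _).trans ((trans _ _).monotone ((f _).monotone ?_))
    rw [← trans_coord x (Nat.le_succ n)]
    exact (trans_trans_le _ _ _ _).trans (trans_self _ _).le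
  choose g hg hgc using fun x => exists_isLUB_range (hc x)
  have hmono : Monotone g := by
    intro x y hxy
    refine (hg x).2 ?_
    rintro _ ⟨n, rfl⟩
    exact (embed_mono n ((f n).monotone (hxy n))).trans ((hg y).1 ⟨n, rfl⟩)
  have hcont : ScottContinuous g := by
    refine scottContinuous_iff.2 ⟨hmono, fun x k => ?_⟩
    obtain ⟨N, hN⟩ := hgc x k
    refine ⟨N, (hN N le_rfl).le.trans ?_⟩
    have : c x N = c (trunc N x) N := by
      change embed N _ = embed N _
      rw [coord_trunc_of_le le_rfl]
    rw [this]
    exact (hg _).1 ⟨N, rfl⟩ k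
  refine ⟨⟨g, hcont⟩, fun n => OrderHom.ext _ _ (funext fun x => ?_)⟩
  obtain ⟨N, hN⟩ := hgc (embed n x) n
  change (g (embed n x)).coord n = _
  -- The index is at least `N`, so that coordinate `n` has stabilised, and at least `n`, so that
  -- coherence applies.
  rw [hN (max N n) (le_max_left _ _)]
  exact hf' n _ (le_max_right _ _) x

/-- The projections between positive levels preserve the outermost constructor, so the one found at
coordinate `1` recurs at all later coordinates. Its components form coherent sequences, hence
elements of `D`; for functions this is `exists_cont`. -/
theorem fold_surjective : Function.Surjective fold := by
  intro d
  have hc : ∀ n, Shape.map (trans (n + 1) n)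
      (fun g => ((trans (n + 1) n).comp g).comp (trans n (n + 1))) (d.coord (n + 2)) =
      d.coord (n + 1) := by
    intro n
    have := d.compat (n + 1)
    rw [trans_succ] at this
    exact this
  have key : ∀ s, (∀ n, (fold s).coord (n + 1) = d.coord (n + 1)) → ∃ s, fold s = d := by
    refine fun s hs => ⟨s, D.ext (funext fun n => ?_)⟩
    cases n with
    | zero => rfl
    | succ n => exact hs n
  -- Making the positive coordinates an opaque sequence of shapes allows a case distinction on their
  -- constructors.
  let c : ∀ n, Shape (Approx n) (Approx n →o Approx n) := fun n => d.coord (n + 1)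
  have hc' : ∀ n, Shape.map (trans (n + 1) n)
      (fun g => ((trans (n + 1) n).comp g).comp (trans n (n + 1))) (c (n + 1)) = c n := hc
  have key' : ∀ s : Shape D Cont, (∀ n, s.map (fun x => x.coord n) (fun f => restrict f n) = c n) →
      ∃ s, fold s = d := key
  clear_value c
  clear key hc
  cases h0 : c 0 with
  | bot =>
    have : ∀ n, c n = .bot := by
      intro n
      induction n with
      | zero => exact h0
      | succ n ih =>
        have := hc' n
        rw [ih] at this
        cases h : c (n + 1) <;> rw [h] at this <;> cases this
    exact key' .bot fun n => (this n).symm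
  | nil =>
    have : ∀ n, c n = .nil := by
      intro n
      induction n with
      | zero => exact h0
      | succ n ih =>
        have := hc' n
        rw [ih] at this
        cases h : c (n + 1) <;> rw [h] at this <;> cases this
    exact key' .nil fun n => (this n).symm
  | left x =>
    have : ∀ n, ∃ x, c n = .left x := by
      intro n
      induction n with
      | zero => exact ⟨_, h0⟩
      | succ n ih =>
        obtain ⟨y, hy⟩ := ih
        have := hc' n
        rw [hy] at this
        cases h : c (n + 1) <;> rw [h] at this <;> cases this
        exact ⟨_, rfl⟩
    choose x hx using this
    refine key' (.left ⟨x, fun n => ?_⟩) fun n => (hx n).symm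
    have := hc' n
    rw [hx, hx] at this
    exact Shape.left.inj this
  | right x =>
    have : ∀ n, ∃ x, c n = .right x := by
      intro n
      induction n with
      | zero => exact ⟨_, h0⟩
      | succ n ih =>
        obtain ⟨y, hy⟩ := ih
        have := hc' n
        rw [hy] at this
        cases h : c (n + 1) <;> rw [h] at this <;> cases this
        exact ⟨_, rfl⟩
    choose x hx using this
    refine key' (.right ⟨x, fun n => ?_⟩) fun n => (hx n).symm
    have := hc' n
    rw [hx, hx] at this
    exact Shape.right.inj this
  | pair x y =>
    have : ∀ n, ∃ x y, c n = .pair x y := by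
      intro n
      induction n with
      | zero => exact ⟨_, _, h0⟩
      | succ n ih =>
        obtain ⟨y, z, hy⟩ := ih
        have := hc' n
        rw [hy] at this
        cases h : c (n + 1) <;> rw [h] at this <;> cases this
        exact ⟨_, _, rfl⟩
    choose x y hx using this
    refine key' (.pair ⟨x, fun n => ?_⟩ ⟨y, fun n => ?_⟩) fun n => (hx n).symm
    all_goals
      have := hc' n
      rw [hx, hx] at this
    · exact (Shape.pair.inj this).1
    · exact (Shape.pair.inj this).2
  | amb x y =>
    have : ∀ n, ∃ x y, c n = .amb x y := by
      intro n
      induction n with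
      | zero => exact ⟨_, _, h0⟩
      | succ n ih =>
        obtain ⟨y, z, hy⟩ := ih
        have := hc' n
        rw [hy] at this
        cases h : c (n + 1) <;> rw [h] at this <;> cases this
        exact ⟨_, _, rfl⟩
    choose x y hx using this
    refine key' (.amb ⟨x, fun n => ?_⟩ ⟨y, fun n => ?_⟩) fun n => (hx n).symm
    all_goals
      have := hc' n
      rw [hx, hx] at this
    · exact (Shape.amb.inj this).1
    · exact (Shape.amb.inj this).2
  | fn f =>
    have : ∀ n, ∃ f, c n = .fn f := by
      intro n
      induction n with
      | zero => exact ⟨_, h0⟩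
      | succ n ih =>
        obtain ⟨y, hy⟩ := ih
        have := hc' n
        rw [hy] at this
        cases h : c (n + 1) <;> rw [h] at this <;> cases this
        exact ⟨_, rfl⟩
    choose f hf using this
    obtain ⟨g, hg⟩ := exists_cont f fun n x => by
      have := hc' n
      rw [hf, hf] at this
      exact DFunLike.congr_fun (Shape.fn.inj this) x
    exact key' (.fn g) fun n => by rw [hf, ← hg]; rfl

@[simp]
theorem unfold_fold (s : Shape D Cont) : (fold s).unfold = s :=
  Function.leftInverse_invFun fold_injective s

theorem fold_unfold (d : D) : fold d.unfold = d := Function.invFun_eq (fold_surjective d)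

theorem eq_fold {d : D} {s : Shape D Cont} (h : d.unfold = s) : d = fold s := by
  rw [← h, fold_unfold]

theorem unfold_mono {d e : D} (h : d ≤ e) : Shape.Le d.unfold e.unfold :=
  fold_le_iff.1 (by rwa [fold_unfold, fold_unfold])

@[simp] theorem unfold_bot : D.bot.unfold = .bot := unfold_fold _
@[simp] theorem unfold_nil : D.nil.unfold = .nil := unfold_fold _
@[simp] theorem unfold_left (a : D) : (D.left a).unfold = .left a := unfold_fold _
@[simp] theorem unfold_right (a : D) : (D.right a).unfold = .right a := unfold_fold _
@[simp] theorem unfold_pair (a b : D) : (D.pair a b).unfold = .pair a b := unfold_fold _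
@[simp] theorem unfold_amb (a b : D) : (D.amb a b).unfold = .amb a b := unfold_fold _

theorem fn_eq {f : D → D} (hf : ScottContinuous f) : D.fn f = fold (.fn ⟨f, hf⟩) := dif_pos hf

theorem unfold_fn {f : D → D} (hf : ScottContinuous f) : (D.fn f).unfold = .fn ⟨f, hf⟩ := by
  rw [fn_eq hf, unfold_fold]

theorem bot_le (d : D) : D.bot ≤ d := by
  rw [← fold_unfold d]
  exact fold_le_iff.2 (.bot _)

theorem coord_bot (n : ℕ) : D.bot.coord n = ⊥ := by cases n <;> rfl

theorem scottContinuous_trunc (m : ℕ) : ScottContinuous (trunc m) :=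
  scottContinuous_iff.2 ⟨trunc_mono m, fun x k => ⟨m, by rw [trunc_trunc le_rfl]⟩⟩

theorem scottContinuous_comp {f g : D → D} (hg : ScottContinuous g) (hf : ScottContinuous f) :
    ScottContinuous fun x => g (f x) := by
  refine scottContinuous_iff.2 ⟨hg.monotone.comp hf.monotone, fun x k => ?_⟩
  obtain ⟨m, hm⟩ := (scottContinuous_iff.1 hg).2 (f x) k
  obtain ⟨n, hn⟩ := (scottContinuous_iff.1 hf).2 x m
  exact ⟨n, hm.trans (hg.monotone (trunc_le_of_coord_le hn) k)⟩

/-- Truncation of a function on both sides. -/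
def Cont.trunc (m : ℕ) (f : Cont) : Cont :=
  ⟨fun x => D.trunc m (f.1 (D.trunc m x)), scottContinuous_comp (scottContinuous_trunc m)
    (scottContinuous_comp f.2 (scottContinuous_trunc m))⟩

/-- One constructor uses up one level; this is the source of every `m + 1` in the estimates below.
-/
theorem trunc_fold (m : ℕ) (s : Shape D Cont) :
    trunc (m + 1) (fold s) = fold (s.map (trunc m) (Cont.trunc m)) := by
  refine D.ext (funext fun k => ?_)
  cases k with
  | zero => rfl
  | succ k =>
    rw [coord_trunc, trans_succ]
    cases s <;> rfl

/-! ### Least fixed points -/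

theorem iterate_mono {f : D → D} (hf : Monotone f) : Monotone fun n => f^[n] D.bot := by
  refine monotone_nat_of_le_succ fun n => ?_
  rw [Function.iterate_succ_apply]
  exact hf.iterate n (bot_le _)

/-- Kleene's theorem: the supremum of the iterates is a fixed point by continuity and lies below any
other one. In particular, the default value in `lfp` is not taken. -/
theorem isLUB_lfp {f : D → D} (hf : ScottContinuous f) :
    IsLUB (Set.range fun n => f^[n] D.bot) (lfp f) := by
  obtain ⟨a, ha, -⟩ := exists_isLUB_range (iterate_mono hf.monotone)
  have hfa : f a = a := by
    refine IsLUB.unique (hf (Set.range_nonempty _)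
      (directedOn_range (iterate_mono hf.monotone)) ha) ⟨?_, fun b hb => ha.2 ?_⟩
    · rintro _ ⟨_, ⟨n, rfl⟩, rfl⟩
      change f (f^[n] D.bot) ≤ a
      rw [← Function.iterate_succ_apply' f n]
      exact ha.1 ⟨n + 1, rfl⟩
    · rintro _ ⟨n, rfl⟩
      cases n with
      | zero => exact bot_le b
      | succ n => exact hb ⟨_, ⟨n, rfl⟩, (Function.iterate_succ_apply' f n _).symm⟩
  have hl : IsLeast {a | f a = a} a := by
    refine ⟨hfa, fun b hb => ha.2 ?_⟩
    rintro _ ⟨n, rfl⟩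
    change f^[n] D.bot ≤ b
    rw [← Function.iterate_fixed (show f b = b from hb) n]
    exact hf.monotone.iterate n (bot_le b)
  have hex : ∃ a, IsLeast {a | f a = a} a := ⟨a, hl⟩
  have : lfp f = a := by
    unfold lfp
    rw [dif_pos hex]
    exact hex.choose_spec.unique hl
  rwa [this]

theorem apply_lfp {f : D → D} (hf : ScottContinuous f) : f (lfp f) = lfp f := by
  refine IsLUB.unique (hf (Set.range_nonempty _)
    (directedOn_range (iterate_mono hf.monotone)) (isLUB_lfp hf)) ⟨?_, fun b hb =>
      (isLUB_lfp hf).2 ?_⟩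
  · rintro _ ⟨_, ⟨n, rfl⟩, rfl⟩
    change f (f^[n] D.bot) ≤ _
    rw [← Function.iterate_succ_apply' f n]
    exact (isLUB_lfp hf).1 ⟨n + 1, rfl⟩
  · rintro _ ⟨n, rfl⟩
    cases n with
    | zero => exact bot_le b
    | succ n => exact hb ⟨_, ⟨n, rfl⟩, (Function.iterate_succ_apply' f n _).symm⟩

theorem coord_lfp {f : D → D} (hf : ScottContinuous f) (k : ℕ) :
    ∃ n, (lfp f).coord k = (f^[n] D.bot).coord k := by
  obtain ⟨_, ⟨n, rfl⟩, h⟩ := coord_isLUB (Set.range_nonempty _)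
    (directedOn_range (iterate_mono hf.monotone)) (isLUB_lfp hf) k
  exact ⟨n, h⟩

end D

/-! ### Continuity of the operations on `D` and of denotations -/

namespace D

theorem fold_ne_bot {s : Shape D Cont} (h : s ≠ .bot) : fold s ≠ D.bot :=
  fun e => h (fold_injective e)

theorem eq_bot_iff {d : D} : d = D.bot ↔ d.unfold = .bot :=
  ⟨fun h => by rw [h, unfold_bot], fun h => eq_fold h⟩

theorem eq_bot_of_le {d : D} (h : d ≤ D.bot) : d = D.bot := le_antisymm h (bot_le d)

/-- Level `1` retains the outermost constructor, whereas `trunc 0` is constantly `⊥`. Hence the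
strictness test of strict application is decided at any positive level. -/
theorem trunc_succ_ne_bot {d : D} (h : d ≠ D.bot) (m : ℕ) : trunc (m + 1) d ≠ D.bot := by
  rw [← fold_unfold d, trunc_fold]
  refine fold_ne_bot fun e => h (eq_bot_iff.2 ?_)
  cases hd : d.unfold <;> rw [hd] at e <;> first | rfl | cases e

/-- Application on `D`. -/
noncomputable def apply (x y : D) : D :=
  match x.unfold with
  | .fn f => f.1 y
  | _ => D.bot

open Classical in
/-- Strict application on `D`. -/
noncomputable def strictApply (x y : D) : D := if y = D.bot then D.bot else x.apply y

/-- The fixed point operator on `D`. -/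
noncomputable def fixpoint (x : D) : D :=
  match x.unfold with
  | .fn f => lfp f.1
  | _ => D.bot

theorem apply_fold (f : Cont) (y : D) : (fold (.fn f)).apply y = f.1 y := by
  simp [apply]

theorem apply_eq_bot {x : D} (h : ∀ f, x.unfold ≠ .fn f) (y : D) : x.apply y = D.bot := by
  unfold apply
  split
  · exact absurd ‹_› (h _)
  · rfl

theorem fixpoint_fold (f : Cont) : (fold (.fn f)).fixpoint = lfp f.1 := by
  simp [fixpoint]

theorem fixpoint_eq_bot {x : D} (h : ∀ f, x.unfold ≠ .fn f) : x.fixpoint = D.bot := by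
  unfold fixpoint
  split
  · exact absurd ‹_› (h _)
  · rfl

theorem apply_mono {x x' y y' : D} (hx : x ≤ x') (hy : y ≤ y') : x.apply y ≤ x'.apply y' := by
  by_cases h : ∃ f, x.unfold = .fn f
  · obtain ⟨f, hf⟩ := h
    have hle := unfold_mono hx
    rw [hf] at hle
    generalize hx' : x'.unfold = s at hle
    cases hle with
    | @fn _ g hle =>
      rw [eq_fold hf, eq_fold hx', apply_fold, apply_fold]
      exact (hle y).trans (g.2.monotone hy)
  · rw [apply_eq_bot (not_exists.1 h)]
    exact bot_le _

theorem exists_trunc_apply_le (x y : D) (k : ℕ) :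
    ∃ m, trunc k (x.apply y) ≤ (trunc m x).apply (trunc m y) := by
  by_cases h : ∃ f, x.unfold = .fn f
  · obtain ⟨f, hf⟩ := h
    rw [eq_fold hf, apply_fold]
    obtain ⟨m, hkm, hm⟩ := f.exists_le y k
    -- Truncating `Fun(f)` at `m + 1` truncates `f` on both sides at `m`.
    refine ⟨m + 1, ?_⟩
    rw [trunc_fold, Shape.map, apply_fold]
    change _ ≤ trunc m (f.1 (trunc m (trunc (m + 1) y)))
    rw [trunc_trunc (Nat.le_succ m)]
    exact (embed_mono k hm).trans (trunc_le_trunc hkm _)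
  · rw [apply_eq_bot (not_exists.1 h)]
    exact ⟨0, (trunc_le _ _).trans (bot_le _)⟩

theorem strictApply_of_ne {y : D} (hy : y ≠ D.bot) (x : D) : x.strictApply y = x.apply y :=
  if_neg hy

theorem strictApply_bot (x : D) : x.strictApply D.bot = D.bot := if_pos rfl

theorem strictApply_mono {x x' y y' : D} (hx : x ≤ x') (hy : y ≤ y') :
    x.strictApply y ≤ x'.strictApply y' := by
  by_cases h : y = D.bot
  · rw [h, strictApply_bot]
    exact bot_le _
  · rw [strictApply_of_ne h, strictApply_of_ne fun e => h (eq_bot_of_le (e ▸ hy))]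
    exact apply_mono hx hy

theorem exists_trunc_strictApply_le (x y : D) (k : ℕ) :
    ∃ m, trunc k (x.strictApply y) ≤ (trunc m x).strictApply (trunc m y) := by
  by_cases h : y = D.bot
  · rw [h, strictApply_bot]
    exact ⟨0, (trunc_le _ _).trans (bot_le _)⟩
  · obtain ⟨m, hm⟩ := exists_trunc_apply_le x y k
    refine ⟨m + 1, ?_⟩
    rw [strictApply_of_ne h, strictApply_of_ne (trunc_succ_ne_bot h m)]
    exact hm.trans (apply_mono (trunc_le_trunc (Nat.le_succ m) x) (trunc_le_trunc (Nat.le_succ m) y))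

theorem lfp_mono {f g : Cont} (h : f ≤ g) : lfp f.1 ≤ lfp g.1 := by
  refine (isLUB_lfp f.2).2 ?_
  rintro _ ⟨n, rfl⟩
  refine le_trans ?_ ((isLUB_lfp g.2).1 ⟨n, rfl⟩)
  exact f.2.monotone.iterate_le_of_le h n _

theorem fixpoint_mono {x x' : D} (hx : x ≤ x') : x.fixpoint ≤ x'.fixpoint := by
  by_cases h : ∃ f, x.unfold = .fn f
  · obtain ⟨f, hf⟩ := h
    have hle := unfold_mono hx
    rw [hf] at hle
    generalize hx' : x'.unfold = s at hle
    cases hle with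
    | fn hle =>
      rw [eq_fold hf, eq_fold hx', fixpoint_fold, fixpoint_fold]
      exact lfp_mono hle
  · rw [fixpoint_eq_bot (not_exists.1 h)]
    exact bot_le _

theorem exists_trunc_iterate_le (x : D) (n k : ℕ) :
    ∃ m, trunc k (x.apply^[n] D.bot) ≤ (trunc m x).apply^[n] D.bot := by
  induction n generalizing k with
  | zero => exact ⟨0, trunc_le _ _⟩
  | succ n ih =>
    obtain ⟨m₁, h₁⟩ := exists_trunc_apply_le x (x.apply^[n] D.bot) k
    obtain ⟨m₂, h₂⟩ := ih m₁
    refine ⟨max m₁ m₂, ?_⟩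
    rw [Function.iterate_succ_apply', Function.iterate_succ_apply']
    refine h₁.trans (apply_mono (trunc_le_trunc (le_max_left _ _) x) (h₂.trans ?_))
    have : ∀ {x x' : D}, x ≤ x' → x.apply^[n] D.bot ≤ x'.apply^[n] D.bot := fun {x x'} h =>
      Monotone.iterate_le_of_le (fun _ _ h => apply_mono le_rfl h)
        (fun y => apply_mono h (le_refl y)) n _
    exact this (trunc_le_trunc (le_max_right _ _) x)

/-- Level `k` of the fixed point is reached by finitely many iterations from `⊥`, and a fixed number
of applications needs only a truncation of the function. -/
theorem exists_trunc_fixpoint_le (x : D) (k : ℕ) :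
    ∃ m, trunc k x.fixpoint ≤ (trunc m x).fixpoint := by
  by_cases h : ∃ f, x.unfold = .fn f
  · obtain ⟨f, hf⟩ := h
    have key : ∀ (f : Cont) n, (fold (.fn f)).apply^[n] D.bot = f.1^[n] D.bot := by
      intro f n
      congr 2
      exact funext fun y => apply_fold f y
    obtain ⟨n, hn⟩ := coord_lfp f.2 k
    obtain ⟨m, hm⟩ := exists_trunc_iterate_le x n k
    -- The level is raised to a successor so that the truncation of `Fun(f)` is again a function.
    refine ⟨m + 1, ?_⟩
    rw [eq_fold hf] at hm ⊢
    have : (trunc m (fold (.fn f))).apply^[n] D.bot ≤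
        (trunc (m + 1) (fold (.fn f))).apply^[n] D.bot :=
      Monotone.iterate_le_of_le (fun _ _ h => apply_mono le_rfl h)
        (fun y => apply_mono (trunc_le_trunc (Nat.le_succ m) _) (le_refl y)) n _
    replace hm := hm.trans this
    rw [key, trunc_fold, Shape.map, key] at hm
    rw [fixpoint_fold, trunc_fold, Shape.map, fixpoint_fold]
    refine le_trans ?_ (hm.trans ((isLUB_lfp (Cont.trunc m f).2).1 ⟨n, rfl⟩))
    exact embed_mono k hn.le
  · rw [fixpoint_eq_bot (not_exists.1 h)]
    exact ⟨0, (trunc_le _ _).trans (bot_le _)⟩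

/-- Truncation of an environment. -/
def truncEnv {ι : Type} (m : ℕ) (η : ι → D) : ι → D := fun i => trunc m (η i)

theorem truncEnv_le_truncEnv {ι : Type} {m k : ℕ} (h : m ≤ k) (η : ι → D) :
    truncEnv m η ≤ truncEnv k η := fun i => trunc_le_trunc h (η i)

theorem truncEnv_ext {n : ℕ} (m : ℕ) (d : D) (η : Fin n → D) :
    truncEnv m (ext d η) = ext (trunc m d) (truncEnv m η) := by
  funext i
  refine Fin.cases ?_ (fun i => ?_) i <;> rfl

theorem ext_mono {n : ℕ} {d d' : D} {η η' : Fin n → D} (hd : d ≤ d') (hη : η ≤ η') :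
    ext d η ≤ ext d' η' := fun i => by
  refine Fin.cases ?_ (fun i => ?_) i
  · exact hd
  · exact hη i

/-- Scott continuity of a function on environments, in terms of truncations. -/
def Cts {ι : Type} (G : (ι → D) → D) : Prop :=
  Monotone G ∧ ∀ η k, ∃ m, trunc k (G η) ≤ G (truncEnv m η)

namespace Cts

variable {ι : Type}

theorem exists_ge {G : (ι → D) → D} (h : Cts G) (η : ι → D) (k l : ℕ) :
    ∃ m ≥ l, trunc k (G η) ≤ G (truncEnv m η) := by
  obtain ⟨m, hm⟩ := h.2 η k
  exact ⟨max m l, le_max_right _ _, hm.trans (h.1 (truncEnv_le_truncEnv (le_max_left _ _) η))⟩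

theorem const (d : D) : Cts fun _ : ι → D => d := ⟨fun _ _ _ => le_rfl, fun _ _ => ⟨0, trunc_le _ _⟩⟩

theorem eval (i : ι) : Cts fun η : ι → D => η i := ⟨fun _ _ h => h i, fun _ k => ⟨k, le_rfl⟩⟩

/-- Suited to constructors, whose truncations are computed by `trunc_fold` at successor levels only.
-/
theorem of_succ {G : (ι → D) → D} (hG : Monotone G)
    (h : ∀ η k, ∃ m, trunc (k + 1) (G η) ≤ G (truncEnv m η)) : Cts G :=
  ⟨hG, fun η k => (h η k).imp fun _ hm => (trunc_le_trunc (Nat.le_succ k) _).trans hm⟩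

theorem comp₁ {G : (ι → D) → D} (hG : Cts G) {F : D → D} (hF : Monotone F)
    (h : ∀ x k, ∃ m, trunc k (F x) ≤ F (trunc m x)) : Cts fun η => F (G η) := by
  refine ⟨fun _ _ h => hF (hG.1 h), fun η k => ?_⟩
  obtain ⟨m, hm⟩ := h (G η) k
  obtain ⟨l, hl⟩ := hG.2 η m
  exact ⟨l, hm.trans (hF hl)⟩

theorem comp₂ {G H : (ι → D) → D} (hG : Cts G) (hH : Cts H) {F : D → D → D}
    (hF : ∀ {x x' y y'}, x ≤ x' → y ≤ y' → F x y ≤ F x' y')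
    (h : ∀ x y k, ∃ m, trunc k (F x y) ≤ F (trunc m x) (trunc m y)) :
    Cts fun η => F (G η) (H η) := by
  refine ⟨fun _ _ h => hF (hG.1 h) (hH.1 h), fun η k => ?_⟩
  obtain ⟨m, hm⟩ := h (G η) (H η) k
  obtain ⟨l, hl⟩ := hG.2 η m
  obtain ⟨l', hll, hl'⟩ := hH.exists_ge η m l
  exact ⟨l', hm.trans (hF (hl.trans (hG.1 (truncEnv_le_truncEnv hll η))) hl')⟩

theorem scottContinuous_ext {n : ℕ} {G : (Fin (n + 1) → D) → D} (hG : Cts G) (η : Fin n → D) :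
    ScottContinuous fun d => G (ext d η) := by
  refine scottContinuous_iff.2 ⟨fun _ _ h => hG.1 (ext_mono h le_rfl), fun x k => ?_⟩
  obtain ⟨m, hm⟩ := hG.2 (ext x η) k
  refine ⟨m, ?_⟩
  rw [← coord_trunc_of_le le_rfl]
  refine (hm.trans (hG.1 ?_)) k
  rw [truncEnv_ext]
  exact ext_mono le_rfl fun i => trunc_le _ _

/-- A single truncation of the environment must serve all arguments at once. Truncated at `k`, the
arguments range over the finite set `Approx k`, so a bound on finitely many levels suffices. -/
theorem lam {n : ℕ} {G : (Fin (n + 1) → D) → D} (hG : Cts G) :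
    Cts fun η => D.fn fun d => G (ext d η) := by
  have e : ∀ η, (D.fn fun d => G (ext d η)) = fold (.fn ⟨_, hG.scottContinuous_ext η⟩) :=
    fun η => fn_eq _
  refine of_succ (fun η η' h => ?_) fun η k => ?_
  · simp only [e]
    exact fold_le_iff.2 (.fn fun d => hG.1 (ext_mono le_rfl h))
  · choose m hm using fun y : Approx k => hG.2 (ext (embed k y) η) k
    obtain ⟨l, hl⟩ := (Set.finite_range m).bddAbove
    refine ⟨l, ?_⟩
    simp only [e]
    rw [trunc_fold]
    refine fold_le_iff.2 (.fn fun d => ?_)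
    refine (hm (d.coord k)).trans (hG.1 ?_)
    refine (truncEnv_le_truncEnv (hl ⟨_, rfl⟩) _).trans ?_
    rw [truncEnv_ext]
    exact ext_mono ((trunc_le _ _).trans (trunc_le _ _)) le_rfl

theorem fold_left {G : (ι → D) → D} (hG : Cts G) : Cts fun η => D.left (G η) := by
  refine of_succ (fun η η' h => fold_le_iff.2 (.left (hG.1 h))) fun η k => ?_
  obtain ⟨m, hm⟩ := hG.2 η k
  refine ⟨m, ?_⟩
  simp only [D.left]
  rw [trunc_fold]
  exact fold_le_iff.2 (.left hm)

theorem fold_right {G : (ι → D) → D} (hG : Cts G) : Cts fun η => D.right (G η) := by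
  refine of_succ (fun η η' h => fold_le_iff.2 (.right (hG.1 h))) fun η k => ?_
  obtain ⟨m, hm⟩ := hG.2 η k
  refine ⟨m, ?_⟩
  simp only [D.right]
  rw [trunc_fold]
  exact fold_le_iff.2 (.right hm)

theorem fold_pair {G H : (ι → D) → D} (hG : Cts G) (hH : Cts H) :
    Cts fun η => D.pair (G η) (H η) := by
  refine of_succ (fun η η' h => fold_le_iff.2 (.pair (hG.1 h) (hH.1 h))) fun η k => ?_
  obtain ⟨m, hm⟩ := hG.2 η k
  obtain ⟨m', hmm, hm'⟩ := hH.exists_ge η k m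
  refine ⟨m', ?_⟩
  simp only [D.pair]
  rw [trunc_fold]
  exact fold_le_iff.2 (.pair (hm.trans (hG.1 (truncEnv_le_truncEnv hmm η))) hm')

theorem fold_amb {G H : (ι → D) → D} (hG : Cts G) (hH : Cts H) :
    Cts fun η => D.amb (G η) (H η) := by
  refine of_succ (fun η η' h => fold_le_iff.2 (.amb (hG.1 h) (hH.1 h))) fun η k => ?_
  obtain ⟨m, hm⟩ := hG.2 η k
  obtain ⟨m', hmm, hm'⟩ := hH.exists_ge η k m
  refine ⟨m', ?_⟩
  simp only [D.amb]
  rw [trunc_fold]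
  exact fold_le_iff.2 (.amb (hm.trans (hG.1 (truncEnv_le_truncEnv hmm η))) hm')

/-- Continuity of a case distinction that returns `⊥` unless `G` has one of the shapes in a
given list of clauses. -/
theorem cases {F : D → (ι → D) → D} {G : (ι → D) → D} (hG : Cts G)
    (hF : ∀ {x x' η η'}, x ≤ x' → η ≤ η' → F x η ≤ F x' η')
    (h : ∀ x η k, ∃ m, trunc k (F x η) ≤ F (trunc m x) (truncEnv m η)) :
    Cts fun η => F (G η) η := by
  refine ⟨fun _ _ h => hF (hG.1 h) h, fun η k => ?_⟩
  obtain ⟨m, hm⟩ := h (G η) η k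
  obtain ⟨l, hml, hl⟩ := hG.exists_ge η m m
  exact ⟨l, hm.trans (hF hl (truncEnv_le_truncEnv hml η))⟩

theorem caseSum {n : ℕ} {G : (Fin n → D) → D} {L R : (Fin (n + 1) → D) → D} (hG : Cts G)
    (hL : Cts L) (hR : Cts R) : Cts fun η =>
      match (G η).unfold with
      | .left d => L (ext d η)
      | .right d => R (ext d η)
      | _ => D.bot := by
  refine cases (F := fun x η => match x.unfold with
      | .left d => L (ext d η)
      | .right d => R (ext d η)
      | _ => D.bot) hG ?_ ?_
  · intro x x' η η' hx hη
    have hle := unfold_mono hx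
    generalize x.unfold = s at hle
    generalize x'.unfold = s' at hle
    cases hle with
    | left h => exact hL.1 (ext_mono h hη)
    | right h => exact hR.1 (ext_mono h hη)
    | _ => exact bot_le _
  · intro x η k
    cases hx : x.unfold with
    | left d =>
      -- The branch needs level `m` of the component `d`, so level `m + 1` of the element analysed.
      obtain ⟨m, hm⟩ := hL.2 (ext d η) k
      refine ⟨m + 1, ?_⟩
      rw [eq_fold hx, trunc_fold, unfold_fold]
      exact hm.trans (hL.1 (by
        rw [truncEnv_ext]
        exact ext_mono le_rfl (truncEnv_le_truncEnv (Nat.le_succ m) η)))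
    | right d =>
      obtain ⟨m, hm⟩ := hR.2 (ext d η) k
      refine ⟨m + 1, ?_⟩
      rw [eq_fold hx, trunc_fold, unfold_fold]
      exact hm.trans (hR.1 (by
        rw [truncEnv_ext]
        exact ext_mono le_rfl (truncEnv_le_truncEnv (Nat.le_succ m) η)))
    | _ => exact ⟨0, (trunc_le _ _).trans (bot_le _)⟩

theorem casePair {n : ℕ} {G : (Fin n → D) → D} {N : (Fin (n + 2) → D) → D} (hG : Cts G)
    (hN : Cts N) : Cts fun η =>
      match (G η).unfold with
      | .pair d e => N (ext d (ext e η))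
      | _ => D.bot := by
  refine cases (F := fun x η => match x.unfold with
      | .pair d e => N (ext d (ext e η))
      | _ => D.bot) hG ?_ ?_
  · intro x x' η η' hx hη
    have hle := unfold_mono hx
    generalize x.unfold = s at hle
    generalize x'.unfold = s' at hle
    cases hle with
    | pair h h' => exact hN.1 (ext_mono h (ext_mono h' hη))
    | _ => exact bot_le _
  · intro x η k
    cases hx : x.unfold with
    | pair d e =>
      obtain ⟨m, hm⟩ := hN.2 (ext d (ext e η)) k
      refine ⟨m + 1, ?_⟩
      rw [eq_fold hx, trunc_fold, unfold_fold]
      exact hm.trans (hN.1 (by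
        rw [truncEnv_ext, truncEnv_ext]
        exact ext_mono le_rfl (ext_mono le_rfl (truncEnv_le_truncEnv (Nat.le_succ m) η))))
    | _ => exact ⟨0, (trunc_le _ _).trans (bot_le _)⟩

theorem caseAmb {n : ℕ} {G : (Fin n → D) → D} {N : (Fin (n + 2) → D) → D} (hG : Cts G)
    (hN : Cts N) : Cts fun η =>
      match (G η).unfold with
      | .amb d e => N (ext d (ext e η))
      | _ => D.bot := by
  refine cases (F := fun x η => match x.unfold with
      | .amb d e => N (ext d (ext e η))
      | _ => D.bot) hG ?_ ?_
  · intro x x' η η' hx hη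
    have hle := unfold_mono hx
    generalize x.unfold = s at hle
    generalize x'.unfold = s' at hle
    cases hle with
    | amb h h' => exact hN.1 (ext_mono h (ext_mono h' hη))
    | _ => exact bot_le _
  · intro x η k
    cases hx : x.unfold with
    | amb d e =>
      obtain ⟨m, hm⟩ := hN.2 (ext d (ext e η)) k
      refine ⟨m + 1, ?_⟩
      rw [eq_fold hx, trunc_fold, unfold_fold]
      exact hm.trans (hN.1 (by
        rw [truncEnv_ext, truncEnv_ext]
        exact ext_mono le_rfl (ext_mono le_rfl (truncEnv_le_truncEnv (Nat.le_succ m) η))))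
    | _ => exact ⟨0, (trunc_le _ _).trans (bot_le _)⟩

end Cts

end D

/-! ### Denotations, renaming and substitution -/

namespace Prog

variable {n : ℕ}

theorem den_app (M N : Prog n) (η : Fin n → D) :
    (app M N).den η = (M.den η).apply (N.den η) := rfl

theorem den_sapp (M N : Prog n) (η : Fin n → D) :
    (sapp M N).den η = (M.den η).strictApply (N.den η) := by
  by_cases h : N.den η = D.bot
  · simp only [den, h, D.strictApply_bot, D.unfold_bot]
    cases (M.den η).unfold <;> rfl
  · rw [D.strictApply_of_ne h]
    rw [D.eq_bot_iff] at h
    simp only [den, D.apply]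
    cases (M.den η).unfold <;> cases hN : (N.den η).unfold <;> first | rfl | exact absurd hN h

theorem den_fixp (M : Prog n) (η : Fin n → D) : (fixp M).den η = (M.den η).fixpoint := rfl

/-- This guarantees that `D.fn` is applied only to continuous functions in the semantics, so that
its default value `⊥` never interferes. -/
theorem cts_den (M : Prog n) : D.Cts M.den := by
  induction M with
  | var i => exact .eval i
  | lam M ih => exact ih.lam
  | app M N ihM ihN => exact ihM.comp₂ ihN D.apply_mono D.exists_trunc_apply_le
  | sapp M N ihM ihN =>
    have := ihM.comp₂ ihN D.strictApply_mono D.exists_trunc_strictApply_le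
    rwa [← funext fun η => den_sapp M N η] at this
  | fixp M ih => exact ih.comp₁ (fun _ _ => D.fixpoint_mono) D.exists_trunc_fixpoint_le
  | bot => exact .const _
  | nil => exact .const _
  | left M ih => exact ih.fold_left
  | right M ih => exact ih.fold_right
  | pair M N ihM ihN => exact ihM.fold_pair ihN
  | amb M N ihM ihN => exact ihM.fold_amb ihN
  | caseSum M L R ihM ihL ihR => exact ihM.caseSum ihL ihR
  | casePair M N ihM ihN => exact ihM.casePair ihN
  | caseAmb M N ihM ihN => exact ihM.caseAmb ihN

theorem scottContinuous_den (M : Prog (n + 1)) (η : Fin n → D) :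
    ScottContinuous fun d => M.den (ext d η) := M.cts_den.scottContinuous_ext η

theorem den_lam (M : Prog (n + 1)) (η : Fin n → D) :
    (lam M).den η = D.fold (.fn ⟨_, M.scottContinuous_den η⟩) := D.fn_eq _

theorem ext_comp_liftRen {A : Type} {n m : ℕ} (r : Fin n → Fin m) (x : A) (η : Fin m → A) :
    (fun i => ext x η (liftRen r i)) = ext x fun i => η (r i) := by
  funext i
  refine Fin.cases ?_ (fun i => ?_) i <;> rfl

theorem den_rename {n m : ℕ} (r : Fin n → Fin m) (M : Prog n) (η : Fin m → D) :
    (M.rename r).den η = M.den fun i => η (r i) := by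
  induction M generalizing m with
  | _ => simp only [rename, den, ext_comp_liftRen, *]

theorem den_weaken (M : Prog n) (d : D) (η : Fin n → D) : M.weaken.den (ext d η) = M.den η :=
  den_rename _ _ _

theorem den_liftSub {n m : ℕ} (s : Fin n → Prog m) (d : D) (η : Fin m → D) :
    (fun i => (liftSub s i).den (ext d η)) = ext d fun i => (s i).den η := by
  funext i
  refine Fin.cases ?_ (fun i => ?_) i
  · rfl
  · exact den_weaken _ _ _

theorem den_subst {n m : ℕ} (s : Fin n → Prog m) (M : Prog n) (η : Fin m → D) :
    (M.subst s).den η = M.den fun i => (s i).den η := by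
  induction M generalizing m with
  | _ => simp only [subst, den, den_liftSub, *]

theorem den_ext {n m : ℕ} (s : Fin n → Prog m) (N : Prog m) (η : Fin m → D) :
    (fun i => (ext N s i).den η) = ext (N.den η) fun i => (s i).den η := by
  funext i
  refine Fin.cases ?_ (fun i => ?_) i <;> rfl

theorem den_inst (M : Prog (n + 1)) (N : Prog n) (η : Fin n → D) :
    (M.inst N).den η = M.den (ext (N.den η) η) := by
  rw [inst, den_subst, den_ext]
  rfl

theorem den_inst₂ (M : Prog (n + 2)) (N₁ N₂ : Prog n) (η : Fin n → D) :
    (M.inst₂ N₁ N₂).den η = M.den (ext (N₁.den η) (ext (N₂.den η) η)) := by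
  rw [inst₂, den_subst, den_ext, den_ext]
  rfl

/-! ### Composition of substitutions -/

theorem liftRen_comp {n m k : ℕ} (r : Fin n → Fin m) (q : Fin m → Fin k) :
    (fun i => liftRen q (liftRen r i)) = liftRen fun i => q (r i) := by
  funext i
  refine Fin.cases ?_ (fun i => ?_) i <;> rfl

theorem rename_rename {n m k : ℕ} (r : Fin n → Fin m) (q : Fin m → Fin k) (M : Prog n) :
    (M.rename r).rename q = M.rename fun i => q (r i) := by
  induction M generalizing m k with
  | _ => simp only [rename, liftRen_comp, *]

theorem liftSub_liftRen {n m k : ℕ} (r : Fin n → Fin m) (s : Fin m → Prog k) :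
    (fun i => liftSub s (liftRen r i)) = liftSub fun i => s (r i) := by
  funext i
  refine Fin.cases ?_ (fun i => ?_) i <;> rfl

theorem subst_rename {n m k : ℕ} (r : Fin n → Fin m) (s : Fin m → Prog k) (M : Prog n) :
    (M.rename r).subst s = M.subst fun i => s (r i) := by
  induction M generalizing m k with
  | _ => simp only [rename, subst, liftSub_liftRen, *]

theorem rename_liftSub {n m k : ℕ} (s : Fin n → Prog m) (r : Fin m → Fin k) :
    (fun i => (liftSub s i).rename (liftRen r)) = liftSub fun i => (s i).rename r := by
  funext i
  refine Fin.cases rfl (fun i => ?_) i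
  change (s i).weaken.rename _ = ((s i).rename r).weaken
  rw [weaken, weaken, rename_rename, rename_rename]
  rfl

theorem rename_subst {n m k : ℕ} (s : Fin n → Prog m) (r : Fin m → Fin k) (M : Prog n) :
    (M.subst s).rename r = M.subst fun i => (s i).rename r := by
  induction M generalizing m k with
  | _ => simp only [rename, subst, rename_liftSub, *]

theorem liftSub_comp {n m k : ℕ} (s : Fin n → Prog m) (t : Fin m → Prog k) :
    (fun i => (liftSub s i).subst (liftSub t)) = liftSub fun i => (s i).subst t := by
  funext i
  refine Fin.cases rfl (fun i => ?_) i
  change (s i).weaken.subst _ = ((s i).subst t).weaken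
  rw [weaken, weaken, subst_rename, rename_subst]
  rfl

theorem subst_subst {n m k : ℕ} (s : Fin n → Prog m) (t : Fin m → Prog k) (M : Prog n) :
    (M.subst s).subst t = M.subst fun i => (s i).subst t := by
  induction M generalizing m k with
  | _ => simp only [subst, liftSub_comp, *]

theorem liftSub_var : liftSub (var : Fin n → Prog n) = var := by
  funext i
  refine Fin.cases ?_ (fun i => ?_) i <;> rfl

theorem subst_var (M : Prog n) : M.subst var = M := by
  induction M with
  | _ => simp only [subst, liftSub_var, *]

theorem liftSub_subst_ext {n m k : ℕ} (s : Fin n → Prog m) (P : Prog k) (t : Fin m → Prog k) :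
    (fun i => (liftSub s i).subst (ext P t)) = ext P fun i => (s i).subst t := by
  funext i
  refine Fin.cases rfl (fun i => ?_) i
  change (s i).weaken.subst _ = _
  rw [weaken, subst_rename]
  rfl

/-- Contracting a redex inside a substituted program gives one simultaneous substitution, the form
to which the induction hypothesis of the adequacy proof applies. -/
theorem inst_subst_liftSub {m : ℕ} (s : Fin n → Prog m) (M : Prog (n + 1)) (P : Prog m) :
    (M.subst (liftSub s)).inst P = M.subst (ext P s) := by
  rw [inst, subst_subst, liftSub_subst_ext]
  simp only [subst_var]

theorem inst₂_subst_liftSub {m : ℕ} (s : Fin n → Prog m) (M : Prog (n + 2)) (P Q : Prog m) :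
    (M.subst (liftSub (liftSub s))).inst₂ P Q = M.subst (ext P (ext Q s)) := by
  rw [inst₂, subst_subst, liftSub_subst_ext, liftSub_subst_ext]
  simp only [subst_var]

end Prog

/-! ### Weak head normal forms and soundness of reduction -/

namespace Prog

section Whnf

variable {n : ℕ}

@[simp] theorem whnf_var (i : Fin n) : ¬ (var i).Whnf := by simp [Whnf, IsCon, IsData, IsLam]
@[simp] theorem whnf_lam (M : Prog (n + 1)) : (lam M).Whnf := by simp [Whnf, IsLam]
@[simp] theorem whnf_app (M N : Prog n) : ¬ (app M N).Whnf := by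
  simp [Whnf, IsCon, IsData, IsLam]
@[simp] theorem whnf_sapp (M N : Prog n) : ¬ (sapp M N).Whnf := by
  simp [Whnf, IsCon, IsData, IsLam]
@[simp] theorem whnf_fixp (M : Prog n) : ¬ (fixp M).Whnf := by simp [Whnf, IsCon, IsData, IsLam]
@[simp] theorem whnf_bot : ¬ (bot : Prog n).Whnf := by simp [Whnf, IsCon, IsData, IsLam]
@[simp] theorem whnf_nil : (nil : Prog n).Whnf := by simp [Whnf, IsCon, IsData]
@[simp] theorem whnf_left (M : Prog n) : (left M).Whnf := by simp [Whnf, IsCon, IsData]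
@[simp] theorem whnf_right (M : Prog n) : (right M).Whnf := by simp [Whnf, IsCon, IsData]
@[simp] theorem whnf_pair (M N : Prog n) : (pair M N).Whnf := by simp [Whnf, IsCon, IsData]
@[simp] theorem whnf_amb (M N : Prog n) : (amb M N).Whnf := by simp [Whnf, IsCon]
@[simp] theorem whnf_caseSum (M : Prog n) (L R : Prog (n + 1)) : ¬ (caseSum M L R).Whnf := by
  simp [Whnf, IsCon, IsData, IsLam]
@[simp] theorem whnf_casePair (M : Prog n) (N : Prog (n + 2)) : ¬ (casePair M N).Whnf := by
  simp [Whnf, IsCon, IsData, IsLam]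
@[simp] theorem whnf_caseAmb (M : Prog n) (N : Prog (n + 2)) : ¬ (caseAmb M N).Whnf := by
  simp [Whnf, IsCon, IsData, IsLam]

theorem Whnf.den_ne_bot {M : Prog n} (h : M.Whnf) (η : Fin n → D) : M.den η ≠ D.bot := by
  cases M <;> simp at h <;> simp [D.eq_bot_iff, den, D.unfold_fn (scottContinuous_den _ _)]

end Whnf

theorem Step.not_whnf {M M' : Prog 0} (h : Step M M') : ¬ M.Whnf := by
  cases h with
  | botLike h => cases h <;> simp
  | _ => simp

theorem IsCon.unfold_den_ne {M : Prog 0} (h : M.IsCon) (f : D.Cont) (η : Fin 0 → D) :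
    (M.den η).unfold ≠ .fn f := by
  cases M <;> simp [IsCon, IsData] at h <;> simp [den]

theorem BotLike.val_eq {M : Prog 0} (h : BotLike M) : M.val = D.bot := by
  cases h with
  | bot => rfl
  | app h => exact D.apply_eq_bot (fun f => h.unfold_den_ne f _) _
  | @sapp M N h =>
    rw [val, den_sapp]
    by_cases hN : N.den Fin.elim0 = D.bot
    · rw [hN, D.strictApply_bot]
    · rw [D.strictApply_of_ne hN]
      exact D.apply_eq_bot (fun f => h.unfold_den_ne f _) _
  | @caseSum M L R h h₁ h₂ =>
    cases M <;> simp at h h₁ h₂ <;> simp [val, den, D.unfold_fn (scottContinuous_den _ _)]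
  | @casePair M N h h₁ =>
    cases M <;> simp at h h₁ <;> simp [val, den, D.unfold_fn (scottContinuous_den _ _)]
  | @caseAmb M N h h₁ =>
    cases M <;> simp at h h₁ <;> simp [val, den, D.unfold_fn (scottContinuous_den _ _)]

/-- The substitution lemmas settle the contractions. Strict β additionally uses that a weak head
normal form never denotes `⊥`, and `rec` uses the fixed point equation. -/
theorem Step.val_eq {M M' : Prog 0} (h : Step M M') : M.val = M'.val := by
  unfold val
  induction h with
  | @beta M N => rw [den_app, den_lam, D.apply_fold, den_inst]
  | app h ih => simp only [den, ih]
  | @sbeta M N h =>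
    rw [den_sapp, den_lam, D.strictApply_of_ne (h.den_ne_bot _), D.apply_fold, den_inst]
  | sappFun h h' ih => simp only [den, ih]
  | sappArg h ih => simp only [den, ih]
  | @fixp M =>
    rw [den_app, den_fixp]
    by_cases h : ∃ f, (M.den Fin.elim0).unfold = .fn f
    · obtain ⟨f, hf⟩ := h
      rw [D.eq_fold hf, D.fixpoint_fold, D.apply_fold, D.apply_lfp f.2]
    · rw [D.fixpoint_eq_bot (not_exists.1 h), D.apply_eq_bot (not_exists.1 h)]
  | caseLeft => rw [den_inst]; simp [den]
  | caseRight => rw [den_inst]; simp [den]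
  | casePair => rw [den_inst₂]; simp [den]
  | caseAmb => rw [den_inst₂]; simp [den]
  | caseSumArg h ih => simp only [den, ih]
  | casePairArg h ih => simp only [den, ih]
  | caseAmbArg h ih => simp only [den, ih]
  | botLike h => exact h.val_eq

/-! ### A deterministic reduction strategy -/

section next

variable {n : ℕ}

/-- `M'` stands for the result of the recursive call on `M` and is used only if `M` is not a weak
head normal form. -/
def nextApp (M M' N : Prog n) : Prog n :=
  match M with
  | lam B => B.inst N
  | nil | left _ | right _ | pair _ _ | amb _ _ => bot
  | _ => app M' N

def nextSapp (M M' N : Prog n) : Prog n :=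
  match M with
  | lam B => B.inst N
  | nil | left _ | right _ | pair _ _ | amb _ _ => bot
  | _ => sapp M' N

def nextCaseSum (M M' : Prog n) (L R : Prog (n + 1)) : Prog n :=
  match M with
  | left P => L.inst P
  | right P => R.inst P
  | nil | pair _ _ | amb _ _ | lam _ => bot
  | _ => caseSum M' L R

def nextCasePair (M M' : Prog n) (N : Prog (n + 2)) : Prog n :=
  match M with
  | pair P Q => N.inst₂ P Q
  | nil | left _ | right _ | amb _ _ | lam _ => bot
  | _ => casePair M' N

def nextCaseAmb (M M' : Prog n) (N : Prog (n + 2)) : Prog n :=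
  match M with
  | amb P Q => N.inst₂ P Q
  | nil | left _ | right _ | pair _ _ | lam _ => bot
  | _ => caseAmb M' N

open Classical in
/-- A function that performs one reduction step unless its argument is in weak head normal form. -/
noncomputable def next : {n : ℕ} → Prog n → Prog n
  | _, app M N => nextApp M M.next N
  | _, sapp M N => if N.Whnf then nextSapp M M.next N else sapp M N.next
  | _, fixp M => app M (fixp M)
  | _, caseSum M L R => nextCaseSum M M.next L R
  | _, casePair M N => nextCasePair M M.next N
  | _, caseAmb M N => nextCaseAmb M M.next N
  | _, M => M

theorem nextApp_of_not_whnf {M : Prog n} (h : ¬ M.Whnf) (M' N : Prog n) :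
    nextApp M M' N = app M' N := by
  cases M <;> simp at h <;> rfl

theorem nextSapp_of_not_whnf {M : Prog n} (h : ¬ M.Whnf) (M' N : Prog n) :
    nextSapp M M' N = sapp M' N := by
  cases M <;> simp at h <;> rfl

theorem nextCaseSum_of_not_whnf {M : Prog n} (h : ¬ M.Whnf) (M' : Prog n) (L R : Prog (n + 1)) :
    nextCaseSum M M' L R = caseSum M' L R := by
  cases M <;> simp at h <;> rfl

theorem nextCasePair_of_not_whnf {M : Prog n} (h : ¬ M.Whnf) (M' : Prog n) (N : Prog (n + 2)) :
    nextCasePair M M' N = casePair M' N := by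
  cases M <;> simp at h <;> rfl

theorem nextCaseAmb_of_not_whnf {M : Prog n} (h : ¬ M.Whnf) (M' : Prog n) (N : Prog (n + 2)) :
    nextCaseAmb M M' N = caseAmb M' N := by
  cases M <;> simp at h <;> rfl

end next

/-- Progress: thanks to the rules for `⊥`-like programs, the only programs stuck without being weak
head normal forms would be variables, and there are no closed ones. -/
theorem step_next : (M : Prog 0) → ¬ M.Whnf → Step M M.next
  | lam _, h | nil, h | left _, h | right _, h | pair _ _, h | amb _ _, h => by simp at h
  | bot, _ => .botLike .bot
  | fixp M, _ => .fixp
  | app M N, _ => by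
    rw [next]
    by_cases h : M.Whnf
    · cases M <;> simp at h <;>
        first | exact .beta | exact .botLike (.app (by simp [IsCon, IsData]))
    · rw [nextApp_of_not_whnf h]
      exact .app (step_next M h)
  | sapp M N, _ => by
    rw [next]
    by_cases hN : N.Whnf
    · rw [if_pos hN]
      by_cases h : M.Whnf
      · cases M <;> simp at h <;>
          first | exact .sbeta hN | exact .botLike (.sapp (by simp [IsCon, IsData]))
      · rw [nextSapp_of_not_whnf h]
        exact .sappFun hN (step_next M h)
    · rw [if_neg hN]
      exact .sappArg (step_next N hN)
  | caseSum M L R, _ => by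
    rw [next]
    by_cases h : M.Whnf
    · cases M <;> simp at h <;>
        first
          | exact .caseLeft
          | exact .caseRight
          | exact .botLike (.caseSum (by simp) (by simp) (by simp))
    · rw [nextCaseSum_of_not_whnf h]
      exact .caseSumArg (step_next M h)
  | casePair M N, _ => by
    rw [next]
    by_cases h : M.Whnf
    · cases M <;> simp at h <;>
        first | exact .casePair | exact .botLike (.casePair (by simp) (by simp))
    · rw [nextCasePair_of_not_whnf h]
      exact .casePairArg (step_next M h)
  | caseAmb M N, _ => by
    rw [next]
    by_cases h : M.Whnf
    · cases M <;> simp at h <;>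
        first | exact .caseAmb | exact .botLike (.caseAmb (by simp) (by simp))
    · rw [nextCaseAmb_of_not_whnf h]
      exact .caseAmbArg (step_next M h)
termination_by M => sizeOf M

/-- On programs that do not denote `⊥`, reduction is deterministic. -/
theorem Step.eq_next {M M' : Prog 0} (h : Step M M') (hM : M.val ≠ D.bot) : M' = M.next := by
  unfold val at hM
  induction h with
  | beta => rfl
  | @app M M' N h ih =>
    rw [next, nextApp_of_not_whnf h.not_whnf, ih]
    -- The evaluated position is strict: if the subprogram denoted `⊥`, so would the whole program.
    intro e
    exact hM (D.apply_eq_bot (by simp [e]) _)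
  | sbeta h => rw [next, if_pos h]; rfl
  | @sappFun M M' N hN h ih =>
    rw [next, if_pos hN, nextSapp_of_not_whnf h.not_whnf, ih]
    intro e
    rw [den_sapp, D.strictApply_of_ne (hN.den_ne_bot _)] at hM
    exact hM (D.apply_eq_bot (by simp [e]) _)
  | @sappArg M N N' h ih =>
    rw [next, if_neg h.not_whnf, ih]
    intro e
    rw [den_sapp, e, D.strictApply_bot] at hM
    exact hM rfl
  | fixp => rfl
  | caseLeft => rfl
  | caseRight => rfl
  | casePair => rfl
  | caseAmb => rfl
  | caseSumArg h ih =>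
    rw [next, nextCaseSum_of_not_whnf h.not_whnf, ih]
    intro e
    exact hM (by simp [den, e])
  | casePairArg h ih =>
    rw [next, nextCasePair_of_not_whnf h.not_whnf, ih]
    intro e
    exact hM (by simp [den, e])
  | caseAmbArg h ih =>
    rw [next, nextCaseAmb_of_not_whnf h.not_whnf, ih]
    intro e
    exact hM (by simp [den, e])
  -- This is the rule that can compete with another one, for instance in `C(M)↓N` with `N`
  -- reducible; it applies only to programs denoting `⊥`.
  | botLike h => exact absurd h.val_eq hM

/-- One step of the deterministic strategy. -/
def NextStep (M M' : Prog 0) : Prop := ¬ M.Whnf ∧ M' = M.next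

/-- Reduction with the deterministic strategy. -/
abbrev Red : Prog 0 → Prog 0 → Prop := Relation.ReflTransGen NextStep

theorem Red.app {M M' : Prog 0} (h : Red M M') (N : Prog 0) : Red (app M N) (app M' N) := by
  refine Relation.ReflTransGen.lift (fun M => Prog.app M N) (fun M M' h => ⟨by simp, ?_⟩) _ _ h
  rw [next, nextApp_of_not_whnf h.1, h.2]

theorem Red.sappArg {N N' : Prog 0} (h : Red N N') (M : Prog 0) : Red (sapp M N) (sapp M N') := by
  refine Relation.ReflTransGen.lift (fun N => Prog.sapp M N) (fun N N' h => ⟨by simp, ?_⟩) _ _ h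
  rw [next, if_neg h.1, h.2]

theorem Red.sappFun {M M' N : Prog 0} (h : Red M M') (hN : N.Whnf) :
    Red (sapp M N) (sapp M' N) := by
  refine Relation.ReflTransGen.lift (fun M => Prog.sapp M N) (fun M M' h => ⟨by simp, ?_⟩) _ _ h
  rw [next, if_pos hN, nextSapp_of_not_whnf h.1, h.2]

theorem Red.caseSum {M M' : Prog 0} (h : Red M M') (L R : Prog 1) :
    Red (caseSum M L R) (caseSum M' L R) := by
  refine Relation.ReflTransGen.lift (fun M => Prog.caseSum M L R) (fun M M' h => ⟨by simp, ?_⟩) _ _ h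
  rw [next, nextCaseSum_of_not_whnf h.1, h.2]

theorem Red.casePair {M M' : Prog 0} (h : Red M M') (N : Prog 2) :
    Red (casePair M N) (casePair M' N) := by
  refine Relation.ReflTransGen.lift (fun M => Prog.casePair M N) (fun M M' h => ⟨by simp, ?_⟩) _ _ h
  rw [next, nextCasePair_of_not_whnf h.1, h.2]

theorem Red.caseAmb {M M' : Prog 0} (h : Red M M') (N : Prog 2) :
    Red (caseAmb M N) (caseAmb M' N) := by
  refine Relation.ReflTransGen.lift (fun M => Prog.caseAmb M N) (fun M M' h => ⟨by simp, ?_⟩) _ _ h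
  rw [next, nextCaseAmb_of_not_whnf h.1, h.2]

theorem Red.next {M : Prog 0} (h : ¬ M.Whnf) : Red M M.next := .single ⟨h, rfl⟩

end Prog

/-! ### Relations between `D` and syntactic codes, by recursion on the approximations -/

/-- A type of codes (programs or types) for elements of `D`: each code can admit `Nil`, determine
codes for the components of a constructor, or relate codes for arguments and values of a
function. -/
structure Frame (C : Type) where
  nil : C → Prop
  left : C → C → Prop
  right : C → C → Prop
  pair : C → C → C → Prop
  amb : C → C → C → Prop
  fn : C → (C → C → Prop) → Prop
  left_unique : ∀ {c a a'}, left c a → left c a' → a = a'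
  right_unique : ∀ {c a a'}, right c a → right c a' → a = a'
  pair_unique : ∀ {c a b a' b'}, pair c a b → pair c a' b' → a = a' ∧ b = b'
  amb_unique : ∀ {c a b a' b'}, amb c a b → amb c a' b' → a = a' ∧ b = b'
  fn_unique : ∀ {c Q Q'}, fn c Q → fn c Q' → Q = Q'

namespace Frame

variable {C : Type} (F : Frame C)

/-- The interpretation of the codes in a lifted separated sum, given interpretations of the codes
in the components. -/
def Lift {X Y : Type} (r : X → C → Prop) (r' : Y → (C → C → Prop) → Prop) :
    Shape X Y → C → Prop
  | .bot, _ => True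
  | .nil, c => F.nil c
  | .left x, c => ∃ a, F.left c a ∧ r x a
  | .right x, c => ∃ a, F.right c a ∧ r x a
  | .pair x y, c => ∃ a b, F.pair c a b ∧ r x a ∧ r y b
  | .amb x y, c => ∃ a b, F.amb c a b ∧ r x a ∧ r y b
  | .fn f, c => ∃ Q, F.fn c Q ∧ r' f Q

/-- `f` maps elements of related codes to each other. -/
def Maps {X : Type} (r : X → C → Prop) (f : X → X) (Q : C → C → Prop) : Prop :=
  ∀ a b, Q a b → ∀ x, r x a → r (f x) b

/-- The interpretation of the codes in the finite approximations of `D`. -/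
def Approximates : (n : ℕ) → Approx n → C → Prop
  | 0, _, _ => True
  | n + 1, x, c => F.Lift (Approximates n)
      (fun f : Approx n →o Approx n => Maps (Approximates n) f)
      (x : Shape (Approx n) (Approx n →o Approx n)) c

/-- The interpretation of the codes in `D`. -/
def Rel (d : D) (c : C) : Prop := ∀ n, F.Approximates n (d.coord n) c

theorem Lift.imp {X Y X' Y' : Type} {r : X → C → Prop} {r' : Y → (C → C → Prop) → Prop}
    {s : X' → C → Prop} {s' : Y' → (C → C → Prop) → Prop} {e : X → X'} {h : Y → Y'}
    (hr : ∀ x a, r x a → s (e x) a) (hr' : ∀ f Q, r' f Q → s' (h f) Q) {x : Shape X Y} {c : C}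
    (hx : F.Lift r r' x c) : F.Lift s s' (x.map e h) c := by
  cases x with
  | bot => trivial
  | nil => exact hx
  | left x => exact Exists.imp (fun a h => ⟨h.1, hr _ _ h.2⟩) hx
  | right x => exact Exists.imp (fun a h => ⟨h.1, hr _ _ h.2⟩) hx
  | pair x y =>
    obtain ⟨a, b, h, h₁, h₂⟩ := hx
    exact ⟨a, b, h, hr _ _ h₁, hr _ _ h₂⟩
  | amb x y =>
    obtain ⟨a, b, h, h₁, h₂⟩ := hx
    exact ⟨a, b, h, hr _ _ h₁, hr _ _ h₂⟩
  | fn f => exact Exists.imp (fun a h => ⟨h.1, hr' _ _ h.2⟩) hx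

theorem Lift.anti {X Y : Type} [PartialOrder X] [PartialOrder Y] {r : X → C → Prop}
    {r' : Y → (C → C → Prop) → Prop} (hr : ∀ x y a, x ≤ y → r y a → r x a)
    (hr' : ∀ f g Q, f ≤ g → r' g Q → r' f Q) {x y : Shape X Y} {c : C} (hxy : Shape.Le x y)
    (hy : F.Lift r r' y c) : F.Lift r r' x c := by
  cases hxy with
  | bot => trivial
  | nil => exact hy
  | left h => exact Exists.imp (fun a h' => ⟨h'.1, hr _ _ _ h h'.2⟩) hy
  | right h => exact Exists.imp (fun a h' => ⟨h'.1, hr _ _ _ h h'.2⟩) hy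
  | pair h h' =>
    obtain ⟨a, b, h₀, h₁, h₂⟩ := hy
    exact ⟨a, b, h₀, hr _ _ _ h h₁, hr _ _ _ h' h₂⟩
  | amb h h' =>
    obtain ⟨a, b, h₀, h₁, h₂⟩ := hy
    exact ⟨a, b, h₀, hr _ _ _ h h₁, hr _ _ _ h' h₂⟩
  | fn h => exact Exists.imp (fun a h' => ⟨h'.1, hr' _ _ _ h h'.2⟩) hy

theorem approximates_bot (n : ℕ) (c : C) : F.Approximates n ⊥ c := by
  cases n <;> trivial

/-- Both directions are proved together: a transported function first carries its argument back, so
each direction calls on the other. -/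
theorem approximates_trans_pair (n m : ℕ) :
    (∀ x c, F.Approximates n x c → F.Approximates m (trans n m x) c) ∧
      ∀ x c, F.Approximates m x c → F.Approximates n (trans m n x) c := by
  induction n generalizing m with
  | zero => exact ⟨fun _ c _ => F.approximates_bot m c, fun _ _ _ => trivial⟩
  | succ n ih =>
    cases m with
    | zero => exact ⟨fun _ _ _ => trivial, fun _ c _ => F.approximates_bot _ c⟩
    | succ m =>
      rw [trans_succ, trans_succ]
      exact ⟨fun x c h => Lift.imp F (ih m).1 (fun f Q hf a b hQ y hy =>
          (ih m).1 _ _ (hf a b hQ _ ((ih m).2 y a hy))) h,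
        fun x c h => Lift.imp F (ih m).2 (fun f Q hf a b hQ y hy =>
          (ih m).2 _ _ (hf a b hQ _ ((ih m).1 y a hy))) h⟩

theorem approximates_trans {n : ℕ} (m : ℕ) {x : Approx n} {c : C} (h : F.Approximates n x c) :
    F.Approximates m (trans n m x) c := (F.approximates_trans_pair n m).1 x c h

theorem approximates_anti {n : ℕ} {x y : Approx n} {c : C} (hxy : x ≤ y)
    (hy : F.Approximates n y c) : F.Approximates n x c := by
  induction n generalizing c with
  | zero => trivial
  | succ n ih =>
    refine Lift.anti F (r := F.Approximates n) (r' := fun f : Approx n →o Approx n => Maps (F.Approximates n) f)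
      (fun x y a h hy => ih h hy) (fun f g Q h hg a b hQ z hz => ?_) hxy hy
    exact ih (h z) (hg a b hQ z hz)

theorem rel_embed {n : ℕ} {x : Approx n} {c : C} (h : F.Approximates n x c) :
    F.Rel (D.embed n x) c := fun m => F.approximates_trans m h

theorem rel_bot (c : C) : F.Rel D.bot c := fun n => by
  rw [D.coord_bot]
  exact F.approximates_bot n c

theorem rel_nil {c : C} : F.Rel D.nil c ↔ F.nil c :=
  ⟨fun h => h 1, fun h n => by cases n <;> trivial⟩

/-- Each level supplies its own code for the component; uniqueness in the frame makes these codes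
coincide. -/
theorem rel_left {d : D} {c : C} : F.Rel (D.left d) c ↔ ∃ a, F.left c a ∧ F.Rel d a := by
  constructor
  · intro h
    obtain ⟨a, ha, -⟩ := h 1
    refine ⟨a, ha, fun n => ?_⟩
    obtain ⟨b, hb, h⟩ := h (n + 1)
    rwa [F.left_unique ha hb]
  · rintro ⟨a, ha, h⟩ n
    cases n with
    | zero => trivial
    | succ n => exact ⟨a, ha, h n⟩

theorem rel_right {d : D} {c : C} : F.Rel (D.right d) c ↔ ∃ a, F.right c a ∧ F.Rel d a := by
  constructor
  · intro h
    obtain ⟨a, ha, -⟩ := h 1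
    refine ⟨a, ha, fun n => ?_⟩
    obtain ⟨b, hb, h⟩ := h (n + 1)
    rwa [F.right_unique ha hb]
  · rintro ⟨a, ha, h⟩ n
    cases n with
    | zero => trivial
    | succ n => exact ⟨a, ha, h n⟩

theorem rel_pair {d e : D} {c : C} :
    F.Rel (D.pair d e) c ↔ ∃ a b, F.pair c a b ∧ F.Rel d a ∧ F.Rel e b := by
  constructor
  · intro h
    obtain ⟨a, b, ha, -⟩ := h 1
    refine ⟨a, b, ha, fun n => ?_, fun n => ?_⟩ <;>
      (obtain ⟨a', b', ha', h₁, h₂⟩ := h (n + 1)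
       obtain ⟨rfl, rfl⟩ := F.pair_unique ha ha'
       assumption)
  · rintro ⟨a, b, ha, h, h'⟩ n
    cases n with
    | zero => trivial
    | succ n => exact ⟨a, b, ha, h n, h' n⟩

theorem rel_amb {d e : D} {c : C} :
    F.Rel (D.amb d e) c ↔ ∃ a b, F.amb c a b ∧ F.Rel d a ∧ F.Rel e b := by
  constructor
  · intro h
    obtain ⟨a, b, ha, -⟩ := h 1
    refine ⟨a, b, ha, fun n => ?_, fun n => ?_⟩ <;>
      (obtain ⟨a', b', ha', h₁, h₂⟩ := h (n + 1)
       obtain ⟨rfl, rfl⟩ := F.amb_unique ha ha'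
       assumption)
  · rintro ⟨a, b, ha, h, h'⟩ n
    cases n with
    | zero => trivial
    | succ n => exact ⟨a, b, ha, h n, h' n⟩

/-- The finite levels only speak of finite arguments. By continuity, a coordinate of `f d` is
bounded by that of `f` at a truncation of `d`, and the relation is downward closed. -/
theorem rel_fn {f : D.Cont} {c : C} :
    F.Rel (D.fold (.fn f)) c ↔ ∃ Q, F.fn c Q ∧ Maps F.Rel f.1 Q := by
  constructor
  · intro h
    obtain ⟨Q, hQ, -⟩ := h 1
    refine ⟨Q, hQ, fun a b hab d hd k => ?_⟩
    obtain ⟨m, hkm, hm⟩ := f.exists_le d k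
    obtain ⟨Q', hQ', hf⟩ := h (m + 1)
    obtain rfl := F.fn_unique hQ hQ'
    refine F.approximates_anti hm ?_
    rw [D.coord_apply_trunc f hkm]
    exact F.approximates_trans k (hf a b hab _ (hd m))
  · rintro ⟨Q, hQ, hf⟩ n
    cases n with
    | zero => trivial
    | succ n => exact ⟨Q, hQ, fun a b hab x hx => hf a b hab _ (F.rel_embed hx) n⟩

/-- Each coordinate of the least fixed point is that of some iterate, which gives the admissibility
required for fixed point induction. -/
theorem rel_lfp {f : D.Cont} {c : C} (h : ∀ n, F.Rel (f.1^[n] D.bot) c) :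
    F.Rel (D.lfp f.1) c := fun k => by
  obtain ⟨n, hn⟩ := D.coord_lfp f.2 k
  rw [hn]
  exact h n k

/-- The interpretation of a code depends on what it determines only. -/
theorem rel_congr {c c' : C} (hnil : F.nil c ↔ F.nil c') (hleft : F.left c = F.left c')
    (hright : F.right c = F.right c') (hpair : F.pair c = F.pair c') (hamb : F.amb c = F.amb c')
    (hfn : F.fn c = F.fn c') (d : D) : F.Rel d c ↔ F.Rel d c' := by
  rw [← D.fold_unfold d]
  cases d.unfold with
  | bot => exact iff_of_true (F.rel_bot c) (F.rel_bot c')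
  | nil => exact F.rel_nil.trans (hnil.trans F.rel_nil.symm)
  | left x => rw [← D.left, F.rel_left, F.rel_left, hleft]
  | right x => rw [← D.right, F.rel_right, F.rel_right, hright]
  | pair x y => rw [← D.pair, F.rel_pair, F.rel_pair, hpair]
  | amb x y => rw [← D.amb, F.rel_amb, F.rel_amb, hamb]
  | fn f => rw [F.rel_fn, F.rel_fn, hfn]

end Frame

/-! ### Normal forms of deterministic relations -/

section Deterministic

open Relation

variable {A : Type} {r : A → A → Prop}

/-- Deterministic reductions do not change the normal form. -/
theorem reflTransGen_iff_of_reduces (hr : ∀ a b b', r a b → r a b' → b = b') {a b v : A}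
    (hv : ∀ w, ¬ r v w) (h : ReflTransGen r a b) : ReflTransGen r a v ↔ ReflTransGen r b v := by
  refine ⟨fun h' => ?_, h.trans⟩
  induction h using ReflTransGen.head_induction_on with
  | refl => exact h'
  | head h₁ _ ih =>
    rcases h'.cases_head with rfl | ⟨c, hc, hcv⟩
    · exact absurd h₁ (hv _)
    · exact ih (hr _ _ _ h₁ hc ▸ hcv)

theorem normal_form_unique (hr : ∀ a b b', r a b → r a b' → b = b') {a v v' : A}
    (hv : ∀ w, ¬ r v w) (hv' : ∀ w, ¬ r v' w) (h : ReflTransGen r a v) (h' : ReflTransGen r a v') :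
    v = v' := by
  rcases ((reflTransGen_iff_of_reduces hr hv' h).1 h').cases_head with h | ⟨w, hw, -⟩
  · exact h
  · exact absurd hw (hv w)

end Deterministic

/-! ### Computational adequacy -/

namespace Prog

theorem NextStep.unique {M N N' : Prog 0} (h : NextStep M N) (h' : NextStep M N') : N = N' :=
  h.2.trans h'.2.symm

theorem Whnf.not_nextStep {M : Prog 0} (h : M.Whnf) (N : Prog 0) : ¬ NextStep M N :=
  fun h' => h'.1 h

theorem Red.unique {M V V' : Prog 0} (h : Red M V) (h' : Red M V') (hV : V.Whnf) (hV' : V'.Whnf) :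
    V = V' :=
  normal_form_unique (r := NextStep) (fun _ _ _ => NextStep.unique) hV.not_nextStep hV'.not_nextStep h h'

theorem Red.iff {M M' V : Prog 0} (h : Red M M') (hV : V.Whnf) : Red M V ↔ Red M' V :=
  reflTransGen_iff_of_reduces (r := NextStep) (fun _ _ _ => NextStep.unique) hV.not_nextStep h

/-- The relation between elements of `D` and the closed programs that realize them. -/
def frame : Frame (Prog 0) where
  nil M := Red M nil
  left M A := Red M (left A)
  right M A := Red M (right A)
  pair M A B := Red M (pair A B)
  amb M A B := Red M (amb A B)
  fn M Q := ∃ B, Red M (lam B) ∧ Q = fun P P' => P' = B.inst P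
  left_unique h h' := Prog.left.inj (h.unique h' (by simp) (by simp))
  right_unique h h' := Prog.right.inj (h.unique h' (by simp) (by simp))
  pair_unique h h' := Prog.pair.inj (h.unique h' (by simp) (by simp))
  amb_unique h h' := Prog.amb.inj (h.unique h' (by simp) (by simp))
  fn_unique := by
    rintro M Q Q' ⟨B, hB, rfl⟩ ⟨B', hB', rfl⟩
    rw [Prog.lam.inj (hB.unique hB' (by simp) (by simp))]

/-- The clauses of the frame only mention the weak head normal form reached, and determinism makes
it the same for both programs. -/
theorem Red.rel_iff {M M' : Prog 0} (h : Red M M') (d : D) : frame.Rel d M ↔ frame.Rel d M' := by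
  refine Frame.rel_congr _ (h.iff (by simp)) (funext fun A => propext (h.iff (by simp)))
    (funext fun A => propext (h.iff (by simp)))
    (funext fun A => funext fun B => propext (h.iff (by simp)))
    (funext fun A => funext fun B => propext (h.iff (by simp))) (funext fun Q => propext ?_) d
  exact exists_congr fun B => and_congr_left' (h.iff (by simp))

theorem rel_next {M : Prog 0} (h : ¬ M.Whnf) {d : D} (hd : frame.Rel d M.next) : frame.Rel d M :=
  ((Red.next h).rel_iff d).2 hd

theorem exists_red_of_rel {M : Prog 0} {d : D} (hd : d ≠ D.bot) (h : frame.Rel d M) :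
    ∃ V, Red M V ∧ V.Whnf := by
  rw [← D.fold_unfold d] at h
  cases hs : d.unfold with
  | bot => exact absurd (D.eq_fold hs) hd
  | nil => rw [hs] at h; exact ⟨_, frame.rel_nil.1 h, by simp⟩
  | left x => rw [hs] at h; obtain ⟨_, h, _⟩ := frame.rel_left.1 h; exact ⟨_, h, by simp⟩
  | right x => rw [hs] at h; obtain ⟨_, h, _⟩ := frame.rel_right.1 h; exact ⟨_, h, by simp⟩
  | pair x y => rw [hs] at h; obtain ⟨_, _, h, _⟩ := frame.rel_pair.1 h; exact ⟨_, h, by simp⟩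
  | amb x y => rw [hs] at h; obtain ⟨_, _, h, _⟩ := frame.rel_amb.1 h; exact ⟨_, h, by simp⟩
  | fn f => rw [hs] at h; obtain ⟨_, ⟨_, h, _⟩, _⟩ := frame.rel_fn.1 h; exact ⟨_, h, by simp⟩

theorem rel_fold_fn {f : D.Cont} {M : Prog 0} : frame.Rel (D.fold (.fn f)) M ↔
    ∃ B, Red M (lam B) ∧ ∀ P d, frame.Rel d P → frame.Rel (f.1 d) (B.inst P) := by
  rw [Frame.rel_fn]
  constructor
  · rintro ⟨_, ⟨B, hB, rfl⟩, h⟩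
    exact ⟨B, hB, fun P d hd => h P _ rfl d hd⟩
  · rintro ⟨B, hB, h⟩
    refine ⟨_, ⟨B, hB, rfl⟩, ?_⟩
    rintro P _ rfl d hd
    exact h P d hd

theorem rel_app {d e : D} {M N : Prog 0} (hM : frame.Rel d M) (hN : frame.Rel e N) :
    frame.Rel (d.apply e) (app M N) := by
  by_cases h : ∃ f, d.unfold = .fn f
  · obtain ⟨f, hf⟩ := h
    rw [D.eq_fold hf] at hM ⊢
    rw [D.apply_fold]
    obtain ⟨B, hB, h⟩ := rel_fold_fn.1 hM
    exact ((hB.app N).rel_iff _).2 (rel_next (by simp) (h N e hN))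
  · rw [D.apply_eq_bot (not_exists.1 h)]
    exact frame.rel_bot _

theorem rel_sapp {d e : D} {M N : Prog 0} (hM : frame.Rel d M) (hN : frame.Rel e N) :
    frame.Rel (d.strictApply e) (sapp M N) := by
  by_cases he : e = D.bot
  · rw [he, D.strictApply_bot]
    exact frame.rel_bot _
  rw [D.strictApply_of_ne he]
  by_cases h : ∃ f, d.unfold = .fn f
  · obtain ⟨f, hf⟩ := h
    rw [D.eq_fold hf] at hM ⊢
    rw [D.apply_fold]
    -- Since `e` is not `⊥`, the argument reaches a weak head normal form, which is what lets the
    -- function part be reduced.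
    obtain ⟨V, hNV, hV⟩ := exists_red_of_rel he hN
    obtain ⟨B, hB, h⟩ := rel_fold_fn.1 hM
    rw [(hNV.sappArg M).rel_iff, (hB.sappFun hV).rel_iff]
    refine rel_next (by simp) ?_
    rw [next, if_pos hV]
    exact h V e ((hNV.rel_iff e).1 hN)
  · rw [D.apply_eq_bot (not_exists.1 h)]
    exact frame.rel_bot _

/-- Fixed point induction: if an iterate is related to `rec M`, then the next one is related to `M
(rec M)`, hence to `rec M` by closure under expansion. -/
theorem rel_fixp {d : D} {M : Prog 0} (hM : frame.Rel d M) : frame.Rel d.fixpoint (fixp M) := by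
  by_cases h : ∃ f, d.unfold = .fn f
  · obtain ⟨f, hf⟩ := h
    rw [D.eq_fold hf] at hM ⊢
    rw [D.fixpoint_fold]
    refine frame.rel_lfp fun n => ?_
    induction n with
    | zero => exact frame.rel_bot _
    | succ n ih =>
      rw [Function.iterate_succ_apply', ← D.apply_fold]
      exact rel_next (by simp) (rel_app hM ih)
  · rw [D.fixpoint_eq_bot (not_exists.1 h)]
    exact frame.rel_bot _

theorem forall_ext {A B : Type} {n : ℕ} {R : A → B → Prop} {a : A} {b : B} {η : Fin n → A}
    {s : Fin n → B} (h : R a b) (h' : ∀ i, R (η i) (s i)) (i : Fin (n + 1)) :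
    R (ext a η i) (ext b s i) := by
  refine Fin.cases ?_ (fun i => ?_) i
  · exact h
  · exact h' i

/-- The fundamental lemma of the logical relation. No typing is involved, because the relation is
stratified by the levels of `D` and not by types. -/
theorem rel_den {n : ℕ} (M : Prog n) {η : Fin n → D} {s : Fin n → Prog 0}
    (h : ∀ i, frame.Rel (η i) (s i)) : frame.Rel (M.den η) (M.subst s) := by
  induction M with
  | var i => exact h i
  | lam M ih =>
    rw [den_lam]
    refine rel_fold_fn.2 ⟨_, .refl, fun P d hd => ?_⟩
    rw [inst_subst_liftSub]
    exact ih (forall_ext hd h)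
  | app M N ihM ihN => exact rel_app (ihM h) (ihN h)
  | sapp M N ihM ihN =>
    rw [den_sapp]
    exact rel_sapp (ihM h) (ihN h)
  | fixp M ih => exact rel_fixp (ih h)
  | bot => exact frame.rel_bot _
  | nil => exact frame.rel_nil.2 .refl
  | left M ih => exact frame.rel_left.2 ⟨_, .refl, ih h⟩
  | right M ih => exact frame.rel_right.2 ⟨_, .refl, ih h⟩
  | pair M N ihM ihN => exact frame.rel_pair.2 ⟨_, _, .refl, ihM h, ihN h⟩
  | amb M N ihM ihN => exact frame.rel_amb.2 ⟨_, _, .refl, ihM h, ihN h⟩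
  | caseSum M L R ihM ihL ihR =>
    have hM := ihM h
    rw [den, subst]
    cases hd : (M.den η).unfold with
    | left d =>
      rw [D.eq_fold hd] at hM
      obtain ⟨A, hA, hdA⟩ := frame.rel_left.1 hM
      refine ((hA.caseSum _ _).rel_iff _).2 (rel_next (by simp) ?_)
      rw [next, nextCaseSum, inst_subst_liftSub]
      exact ihL (forall_ext hdA h)
    | right d =>
      rw [D.eq_fold hd] at hM
      obtain ⟨A, hA, hdA⟩ := frame.rel_right.1 hM
      refine ((hA.caseSum _ _).rel_iff _).2 (rel_next (by simp) ?_)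
      rw [next, nextCaseSum, inst_subst_liftSub]
      exact ihR (forall_ext hdA h)
    | _ => exact frame.rel_bot _
  | casePair M N ihM ihN =>
    have hM := ihM h
    rw [den, subst]
    cases hd : (M.den η).unfold with
    | pair d e =>
      rw [D.eq_fold hd] at hM
      obtain ⟨A, B, hA, hdA, heB⟩ := frame.rel_pair.1 hM
      refine ((hA.casePair _).rel_iff _).2 (rel_next (by simp) ?_)
      rw [next, nextCasePair, inst₂_subst_liftSub]
      exact ihN (forall_ext hdA (forall_ext heB h))
    | _ => exact frame.rel_bot _
  | caseAmb M N ihM ihN =>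
    have hM := ihM h
    rw [den, subst]
    cases hd : (M.den η).unfold with
    | amb d e =>
      rw [D.eq_fold hd] at hM
      obtain ⟨A, B, hA, hdA, heB⟩ := frame.rel_amb.1 hM
      refine ((hA.caseAmb _).rel_iff _).2 (rel_next (by simp) ?_)
      rw [next, nextCaseAmb, inst₂_subst_liftSub]
      exact ihN (forall_ext hdA (forall_ext heB h))
    | _ => exact frame.rel_bot _

/-- Computational adequacy: a closed program that does not denote `⊥` has a weak head normal
form. -/
theorem exists_red {M : Prog 0} (h : M.val ≠ D.bot) : ∃ V, Red M V ∧ V.Whnf := by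
  have := M.rel_den (η := Fin.elim0) (s := var) fun i => i.elim0
  rw [subst_var] at this
  exact exists_red_of_rel h this

/-- Reduction terminates on closed programs that do not denote `⊥`. -/
theorem acc_step {M : Prog 0} (h : M.val ≠ D.bot) : Acc (fun N M => Step M N) M := by
  obtain ⟨V, hMV, hV⟩ := exists_red h
  induction hMV using Relation.ReflTransGen.head_induction_on with
  | refl => exact ⟨_, fun N hN => absurd hV hN.not_whnf⟩
  | head h₁ _ ih =>
    refine ⟨_, fun N hN => ?_⟩
    -- The successor is unique, so accessibility propagates backwards along the one reduction path.
    rw [hN.eq_next h, ← h₁.2]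
    refine ih ?_
    rwa [h₁.2, ← (step_next _ h₁.1).val_eq]

end Prog

/-- `d` has the form `Amb(a,b)`. -/
def D.IsAmb (d : D) : Prop := ∃ a b, d = D.amb a b

/-! ### Types under unfolding of `fix`, and soundness of typing -/

namespace Ty

/-- If the type has the form `fix α₁. … fix αₙ. A(ρ)`, then `ρ` is determined. -/
def AmDetermined : {k : ℕ} → Ty k → Prop
  | _, fix ρ => ρ.AmDetermined
  | _, am ρ => ρ.Determined
  | _, _ => True

theorem Regular.amDetermined {k : ℕ} {ρ : Ty k} (h : ρ.Regular) : ρ.AmDetermined := by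
  induction ρ with
  | fix ρ ih => exact ih h.2
  | am ρ _ => exact h.1
  | _ => trivial

theorem Determined.rename {k l : ℕ} {ρ : Ty k} (h : ρ.Determined) (r : Fin k → Fin l) :
    (ρ.rename r).Determined := by
  induction ρ generalizing l with
  | var i => exact h.elim
  | fix ρ ih => exact ih h _
  | am ρ _ => exact h.elim
  | _ => trivial

theorem AmDetermined.rename {k l : ℕ} {ρ : Ty k} (h : ρ.AmDetermined) (r : Fin k → Fin l) :
    (ρ.rename r).AmDetermined := by
  induction ρ generalizing l with
  | fix ρ ih => exact ih h _
  | am ρ _ => exact Determined.rename h r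
  | _ => trivial

theorem Determined.subst {k l : ℕ} {ρ : Ty k} (h : ρ.Determined) (s : Fin k → Ty l) :
    (ρ.subst s).Determined := by
  induction ρ generalizing l with
  | var i => exact h.elim
  | fix ρ ih => exact ih h _
  | am ρ _ => exact h.elim
  | _ => trivial

theorem AmDetermined.subst {k l : ℕ} {ρ : Ty k} (h : ρ.AmDetermined) {s : Fin k → Ty l}
    (hs : ∀ i, (s i).AmDetermined) : (ρ.subst s).AmDetermined := by
  induction ρ generalizing l with
  | var i => exact hs i
  | fix ρ ih =>
    refine ih h fun i => ?_
    refine Fin.cases ?_ (fun i => ?_) i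
    · trivial
    · exact (hs i).rename _
  | am ρ _ => exact Determined.subst h s
  | _ => trivial

/-- `AmDetermined` is the fragment of regularity that is carried through unfoldings; the substituted
type `fix ρ` satisfies it by hypothesis, which covers a body that is itself the bound variable. -/
theorem AmDetermined.inst_fix {k : ℕ} {ρ : Ty (k + 1)} (h : (fix ρ).AmDetermined) :
    (ρ.inst (fix ρ)).AmDetermined :=
  AmDetermined.subst (ρ := ρ) h fun i => by
    refine Fin.cases ?_ (fun i => ?_) i
    · exact h
    · trivial

/-- Unfolding of an outermost `fix`. -/
def UnfoldStep (τ τ' : Ty 0) : Prop := ∃ ρ : Ty 1, τ = fix ρ ∧ τ' = ρ.inst (fix ρ)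

/-- Repeated unfolding. -/
abbrev Unfolds : Ty 0 → Ty 0 → Prop := Relation.ReflTransGen UnfoldStep

theorem UnfoldStep.unique {τ σ σ' : Ty 0} (h : UnfoldStep τ σ) (h' : UnfoldStep τ σ') :
    σ = σ' := by
  obtain ⟨ρ, rfl, rfl⟩ := h
  obtain ⟨ρ', h, rfl⟩ := h'
  rw [fix.inj h]

theorem not_unfoldStep {τ : Ty 0} (h : ∀ ρ, τ ≠ fix ρ) (σ : Ty 0) : ¬ UnfoldStep τ σ :=
  fun ⟨ρ, e, _⟩ => h ρ e

theorem Unfolds.unique {τ σ σ' : Ty 0} (h : Unfolds τ σ) (h' : Unfolds τ σ')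
    (hσ : ∀ ρ, σ ≠ fix ρ) (hσ' : ∀ ρ, σ' ≠ fix ρ) : σ = σ' :=
  normal_form_unique (r := UnfoldStep) (fun _ _ _ => UnfoldStep.unique) (not_unfoldStep hσ)
    (not_unfoldStep hσ') h h'

theorem Unfolds.iff {τ τ' σ : Ty 0} (h : Unfolds τ τ') (hσ : ∀ ρ, σ ≠ fix ρ) :
    Unfolds τ σ ↔ Unfolds τ' σ :=
  reflTransGen_iff_of_reduces (r := UnfoldStep) (fun _ _ _ => UnfoldStep.unique)
    (not_unfoldStep hσ) h

theorem AmDetermined.unfolds {τ τ' : Ty 0} (h : τ.AmDetermined) (hτ : Unfolds τ τ') :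
    τ'.AmDetermined := by
  induction hτ with
  | refl => exact h
  | tail _ hs ih =>
    obtain ⟨ρ, rfl, rfl⟩ := hs
    exact ih.inst_fix

theorem Determined.unfolds {τ τ' : Ty 0} (h : τ.Determined) (hτ : Unfolds τ τ') :
    τ'.Determined := by
  induction hτ with
  | refl => exact h
  | tail _ hs ih =>
    obtain ⟨ρ, rfl, rfl⟩ := hs
    exact Determined.subst (ρ := ρ) ih _

/-- The interpretation of closed types by means of unfoldings of `fix`. -/
def frame : Frame (Ty 0) where
  nil τ := Unfolds τ one
  left τ ρ := ∃ σ, Unfolds τ (sum ρ σ)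
  right τ σ := ∃ ρ, Unfolds τ (sum ρ σ)
  pair τ ρ σ := Unfolds τ (prod ρ σ)
  amb τ ρ σ := Unfolds τ (am ρ) ∧ ρ = σ
  fn τ Q := ∃ ρ σ, Unfolds τ (arrow ρ σ) ∧ Q = fun a b => a = ρ ∧ b = σ
  left_unique := by
    rintro τ ρ ρ' ⟨σ, h⟩ ⟨σ', h'⟩
    exact (sum.inj (h.unique h' (by simp) (by simp))).1
  right_unique := by
    rintro τ σ σ' ⟨ρ, h⟩ ⟨ρ', h'⟩
    exact (sum.inj (h.unique h' (by simp) (by simp))).2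
  pair_unique h h' := prod.inj (h.unique h' (by simp) (by simp))
  amb_unique := by
    rintro τ ρ _ σ _ ⟨h, rfl⟩ ⟨h', rfl⟩
    have := am.inj (h.unique h' (by simp) (by simp))
    exact ⟨this, this⟩
  fn_unique := by
    rintro τ Q Q' ⟨ρ, σ, h, rfl⟩ ⟨ρ', σ', h', rfl⟩
    obtain ⟨rfl, rfl⟩ := arrow.inj (h.unique h' (by simp) (by simp))
    rfl

theorem Unfolds.rel_iff {τ τ' : Ty 0} (h : Unfolds τ τ') (d : D) :
    frame.Rel d τ ↔ frame.Rel d τ' := by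
  refine Frame.rel_congr _ (h.iff (by simp))
    (funext fun ρ => propext (exists_congr fun σ => h.iff (by simp)))
    (funext fun ρ => propext (exists_congr fun σ => h.iff (by simp)))
    (funext fun ρ => funext fun σ => propext (h.iff (by simp)))
    (funext fun ρ => funext fun σ => propext (and_congr_left' (h.iff (by simp))))
    (funext fun Q => propext ?_) d
  exact exists_congr fun ρ => exists_congr fun σ => and_congr_left' (h.iff (by simp))

/-- In this interpretation the typing rules for folding and unfolding `fix` are sound by
construction. -/
theorem rel_fix {ρ : Ty 1} {d : D} : frame.Rel d (fix ρ) ↔ frame.Rel d (ρ.inst (fix ρ)) :=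
  Unfolds.rel_iff (.single ⟨ρ, rfl, rfl⟩) d

theorem rel_arrow {f : D.Cont} {ρ σ : Ty 0} : frame.Rel (D.fold (.fn f)) (arrow ρ σ) ↔
    ∀ d, frame.Rel d ρ → frame.Rel (f.1 d) σ := by
  rw [Frame.rel_fn]
  constructor
  · rintro ⟨_, ⟨ρ', σ', h, rfl⟩, hf⟩
    obtain ⟨rfl, rfl⟩ := arrow.inj (h.unique .refl (by simp) (by simp))
    exact hf _ _ ⟨rfl, rfl⟩
  · intro h
    refine ⟨_, ⟨ρ, σ, .refl, rfl⟩, ?_⟩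
    rintro _ _ ⟨rfl, rfl⟩
    exact h

theorem rel_sum_left {d : D} {ρ σ : Ty 0} :
    frame.Rel (D.left d) (sum ρ σ) ↔ frame.Rel d ρ := by
  rw [Frame.rel_left]
  constructor
  · rintro ⟨ρ', ⟨σ', h⟩, hd⟩
    rwa [← (sum.inj (h.unique .refl (by simp) (by simp))).1]
  · exact fun h => ⟨ρ, ⟨σ, .refl⟩, h⟩

theorem rel_sum_right {d : D} {ρ σ : Ty 0} :
    frame.Rel (D.right d) (sum ρ σ) ↔ frame.Rel d σ := by
  rw [Frame.rel_right]
  constructor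
  · rintro ⟨σ', ⟨ρ', h⟩, hd⟩
    rwa [← (sum.inj (h.unique .refl (by simp) (by simp))).2]
  · exact fun h => ⟨σ, ⟨ρ, .refl⟩, h⟩

theorem rel_prod {d e : D} {ρ σ : Ty 0} :
    frame.Rel (D.pair d e) (prod ρ σ) ↔ frame.Rel d ρ ∧ frame.Rel e σ := by
  rw [Frame.rel_pair]
  constructor
  · rintro ⟨ρ', σ', h, hd⟩
    obtain ⟨rfl, rfl⟩ := prod.inj (h.unique .refl (by simp) (by simp))
    exact hd
  · exact fun h => ⟨ρ, σ, .refl, h⟩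

theorem rel_am {d e : D} {ρ : Ty 0} :
    frame.Rel (D.amb d e) (am ρ) ↔ frame.Rel d ρ ∧ frame.Rel e ρ := by
  rw [Frame.rel_amb]
  constructor
  · rintro ⟨ρ', _, ⟨h, rfl⟩, hd⟩
    obtain rfl := am.inj (h.unique .refl (by simp) (by simp))
    exact hd
  · exact fun h => ⟨ρ, ρ, ⟨.refl, rfl⟩, h⟩

theorem rel_apply {d e : D} {ρ σ : Ty 0} (hd : frame.Rel d (arrow ρ σ)) (he : frame.Rel e ρ) :
    frame.Rel (d.apply e) σ := by
  by_cases h : ∃ f, d.unfold = .fn f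
  · obtain ⟨f, hf⟩ := h
    rw [D.eq_fold hf] at hd ⊢
    rw [D.apply_fold]
    exact rel_arrow.1 hd e he
  · rw [D.apply_eq_bot (not_exists.1 h)]
    exact frame.rel_bot _

/-- Elements of a determined type are not of the form `Amb(a,b)`. -/
theorem not_isAmb_of_rel {ρ : Ty 0} (hρ : ρ.Determined) {d : D} (h : frame.Rel d ρ) :
    ¬ d.IsAmb := by
  rintro ⟨a, b, rfl⟩
  obtain ⟨σ, _, ⟨hσ, -⟩, -⟩ := frame.rel_amb.1 h
  exact hρ.unfolds hσ

theorem not_isAmb_of_rel_amb {ρ : Ty 0} (hρ : ρ.Regular) {a b : D}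
    (h : frame.Rel (D.amb a b) ρ) : ¬ a.IsAmb ∧ ¬ b.IsAmb := by
  obtain ⟨σ, _, ⟨hσ, rfl⟩, ha, hb⟩ := frame.rel_amb.1 h
  have hdet : σ.Determined := hρ.amDetermined.unfolds hσ
  exact ⟨not_isAmb_of_rel hdet ha, not_isAmb_of_rel hdet hb⟩

end Ty

/-- Soundness of the typing system. -/
theorem Typing.rel_den {n : ℕ} {Γ : Fin n → Ty 0} {M : Prog n} {ρ : Ty 0} (h : Typing Γ M ρ)
    {η : Fin n → D} (hη : ∀ i, Ty.frame.Rel (η i) (Γ i)) : Ty.frame.Rel (M.den η) ρ := by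
  induction h with
  | var i => exact hη i
  | nil => exact Ty.frame.rel_nil.2 .refl
  | bot _ => exact Ty.frame.rel_bot _
  | left _ _ ih => exact Ty.rel_sum_left.2 (ih hη)
  | right _ _ ih => exact Ty.rel_sum_right.2 (ih hη)
  | pair _ _ ih₁ ih₂ => exact Ty.rel_prod.2 ⟨ih₁ hη, ih₂ hη⟩
  | amb _ _ _ ih₁ ih₂ => exact Ty.rel_am.2 ⟨ih₁ hη, ih₂ hη⟩
  | lam _ _ ih =>
    rw [Prog.den_lam]
    exact Ty.rel_arrow.2 fun d hd => ih (Prog.forall_ext hd hη)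
  | @fixp n Γ M ρ _ _ ih =>
    rw [Prog.den_fixp]
    by_cases h : ∃ f, (M.den η).unfold = .fn f
    · obtain ⟨f, hf⟩ := h
      rw [D.eq_fold hf, D.fixpoint_fold]
      -- The premise types `M a` for `a : ρ`, so every iterate from `⊥` stays in `ρ`.
      refine Ty.frame.rel_lfp fun n => ?_
      induction n with
      | zero => exact Ty.frame.rel_bot _
      | succ n ihn =>
        have := ih (Prog.forall_ext (R := fun d ρ => Ty.frame.Rel d ρ) ihn hη)
        rw [Prog.den_app, Prog.den_weaken, D.eq_fold hf, D.apply_fold] at this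
        rw [Function.iterate_succ_apply']
        exact this
    · rw [D.fixpoint_eq_bot (not_exists.1 h)]
      exact Ty.frame.rel_bot _
  | app _ _ ih₁ ih₂ => exact Ty.rel_apply (ih₁ hη) (ih₂ hη)
  | @sapp n Γ M N ρ σ _ _ ih₁ ih₂ =>
    rw [Prog.den_sapp]
    by_cases h : N.den η = D.bot
    · rw [h, D.strictApply_bot]
      exact Ty.frame.rel_bot _
    · rw [D.strictApply_of_ne h]
      exact Ty.rel_apply (ih₁ hη) (ih₂ hη)
  | roll _ _ ih => exact Ty.rel_fix.2 (ih hη)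
  | unroll _ ih => exact Ty.rel_fix.1 (ih hη)
  | @caseSum n Γ M L R ρ σ τ _ _ _ ih₁ ih₂ ih₃ =>
    have hM := ih₁ hη
    rw [Prog.den]
    cases hd : (M.den η).unfold with
    | left d =>
      rw [D.eq_fold hd] at hM
      exact ih₂ (Prog.forall_ext (Ty.rel_sum_left.1 hM) hη)
    | right d =>
      rw [D.eq_fold hd] at hM
      exact ih₃ (Prog.forall_ext (Ty.rel_sum_right.1 hM) hη)
    | _ => exact Ty.frame.rel_bot _
  | @casePair n Γ M N ρ σ τ _ _ ih₁ ih₂ =>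
    have hM := ih₁ hη
    rw [Prog.den]
    cases hd : (M.den η).unfold with
    | pair d e =>
      rw [D.eq_fold hd] at hM
      obtain ⟨h₁, h₂⟩ := Ty.rel_prod.1 hM
      exact ih₂ (Prog.forall_ext h₁ (Prog.forall_ext h₂ hη))
    | _ => exact Ty.frame.rel_bot _
  | @caseAmb n Γ M N ρ τ _ _ ih₁ ih₂ =>
    have hM := ih₁ hη
    rw [Prog.den]
    cases hd : (M.den η).unfold with
    | amb d e =>
      rw [D.eq_fold hd] at hM
      obtain ⟨h₁, h₂⟩ := Ty.rel_am.1 hM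
      exact ih₂ (Prog.forall_ext h₁ (Prog.forall_ext h₂ hη))
    | _ => exact Ty.frame.rel_bot _

/-! ### No nested `Amb` in the denotation of a regular type -/

namespace D

theorem amb_ne_bot (a b : D) : D.amb a b ≠ D.bot := fun h => by cases fold_injective h

theorem amb_le_amb {a b a' b' : D} : D.amb a b ≤ D.amb a' b' ↔ a ≤ a' ∧ b ≤ b' := by
  refine ⟨fun h => ?_, fun h => fold_le_iff.2 (.amb h.1 h.2)⟩
  cases fold_le_iff.1 h with
  | amb h h' => exact ⟨h, h'⟩

theorem amb_inj {a b a' b' : D} (h : D.amb a b = D.amb a' b') : a = a' ∧ b = b' :=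
  Shape.amb.inj (fold_injective h)

theorem eq_bot_or_amb {d a b : D} (h : d ≤ D.amb a b) :
    d = D.bot ∨ ∃ a' b', d = D.amb a' b' ∧ a' ≤ a ∧ b' ≤ b := by
  have hle := unfold_mono h
  rw [unfold_amb] at hle
  generalize hs : d.unfold = s at hle
  cases hle with
  | bot => exact .inl (eq_fold hs)
  | amb h h' => exact .inr ⟨_, _, eq_fold hs, h, h'⟩

theorem IsAmb.mono {d e : D} (hd : d.IsAmb) (h : d ≤ e) : e.IsAmb := by
  obtain ⟨a, b, rfl⟩ := hd
  have hle := unfold_mono h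
  rw [unfold_amb] at hle
  generalize hs : e.unfold = s at hle
  cases hle with
  | amb h h' => exact ⟨_, _, eq_fold hs⟩

theorem eq_bot_of_not_isAmb {d e : D} (hd : ¬ d.IsAmb) (h : d ≤ e) (he : e.IsAmb) :
    d = D.bot := by
  obtain ⟨a, b, rfl⟩ := he
  exact (eq_bot_or_amb h).resolve_right fun ⟨a', b', e, _⟩ => hd ⟨a', b', e⟩

theorem not_isAmb_bot : ¬ D.bot.IsAmb := fun ⟨a, b, h⟩ => amb_ne_bot a b h.symm

/-- Below an `Amb` element there are only `⊥` and `Amb` elements. If a supremum were an `Amb`, the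
whole set would consist of `⊥`, and so would its supremum. -/
theorem isSubdomain_not_isAmb : Ty.IsSubdomain {d | ¬ d.IsAmb} := by
  refine ⟨fun d e h hd he => hd (he.mono h), fun S hS x hx hamb => ?_⟩
  have : x ≤ D.bot := hx.2 fun s hs => (eq_bot_of_not_isAmb (hS hs) (hx.1 hs) hamb).le
  rw [eq_bot_of_le this] at hamb
  exact not_isAmb_bot hamb

/-- If the component `a` of a supremum `Amb(a,b)` were an `Amb`, all first components in the set
would be `⊥`; then `Amb(⊥,b)` would be an upper bound, forcing `a = ⊥`. -/
theorem isSubdomain_amb_not_isAmb :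
    Ty.IsSubdomain {d | ∀ a b, d = D.amb a b → ¬ a.IsAmb ∧ ¬ b.IsAmb} := by
  constructor
  · rintro d _ h hd a b rfl
    obtain ⟨a', b', rfl⟩ := IsAmb.mono ⟨a, b, rfl⟩ h
    obtain ⟨ha, hb⟩ := amb_le_amb.1 h
    exact ⟨fun h => (hd a' b' rfl).1 (h.mono ha), fun h => (hd a' b' rfl).2 (h.mono hb)⟩
  · rintro S hS _ hx a b rfl
    have key : ∀ s ∈ S, (a.IsAmb → s ≤ D.amb D.bot b) ∧ (b.IsAmb → s ≤ D.amb a D.bot) := by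
      intro s hs
      rcases eq_bot_or_amb (hx.1 hs) with rfl | ⟨a', b', rfl, ha, hb⟩
      · exact ⟨fun _ => bot_le _, fun _ => bot_le _⟩
      · obtain ⟨h₁, h₂⟩ := hS hs a' b' rfl
        exact ⟨fun h => amb_le_amb.2 ⟨(eq_bot_of_not_isAmb h₁ ha h).le, hb⟩,
          fun h => amb_le_amb.2 ⟨ha, (eq_bot_of_not_isAmb h₂ hb h).le⟩⟩
    constructor
    · intro h
      have := (amb_le_amb.1 (hx.2 fun s hs => (key s hs).1 h)).1
      rw [eq_bot_of_le this] at h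
      exact not_isAmb_bot h
    · intro h
      have := (amb_le_amb.1 (hx.2 fun s hs => (key s hs).2 h)).2
      rw [eq_bot_of_le this] at h
      exact not_isAmb_bot h

end D

namespace Ty

theorem Determined.not_isAmb {k : ℕ} {ρ : Ty k} (h : ρ.Determined) {ζ : Fin k → Set D} {d : D}
    (hd : d ∈ ρ.den ζ) : ¬ d.IsAmb := by
  rintro ⟨a, b, rfl⟩
  induction ρ generalizing a b with
  | var i => exact h
  | one =>
    rcases hd with h | h
    · cases D.fold_injective h
    · cases D.fold_injective h
  | prod ρ σ =>
    rcases hd with ⟨_, _, _, _, h⟩ | h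
    · cases D.fold_injective h
    · cases D.fold_injective h
  | sum ρ σ =>
    rcases hd with (⟨_, _, h⟩ | ⟨_, _, h⟩) | h
    · cases D.fold_injective h
    · cases D.fold_injective h
    · cases D.fold_injective h
  | arrow ρ σ =>
    rcases hd with ⟨f, hf, _, h⟩ | h
    · rw [D.fn_eq hf] at h
      cases D.fold_injective h
    · cases D.fold_injective h
  | fix ρ ih =>
    -- The non-`Amb` elements are one of the subdomains in the intersection, since the body of the
    -- fixed point is determined in any environment.
    refine hd {d | ¬ d.IsAmb} ⟨D.isSubdomain_not_isAmb, ?_⟩ ⟨a, b, rfl⟩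
    rintro d hd ⟨a, b, rfl⟩
    exact ih h a b hd
  | am ρ => exact h

/-- Determined types contain no `Amb` elements at all, which leaves variables, `fix` and `A`. For
`fix`, the subdomain of elements without directly nested `Amb` is one of the sets intersected. -/
theorem AmDetermined.not_isAmb {k : ℕ} {ρ : Ty k} (h : ρ.AmDetermined) {ζ : Fin k → Set D}
    (hζ : ∀ i, ∀ a b, D.amb a b ∈ ζ i → ¬ a.IsAmb ∧ ¬ b.IsAmb) {a b : D}
    (hd : D.amb a b ∈ ρ.den ζ) : ¬ a.IsAmb ∧ ¬ b.IsAmb := by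
  by_cases hdet : ρ.Determined
  · exact absurd ⟨a, b, rfl⟩ (hdet.not_isAmb hd)
  induction ρ generalizing a b with
  | var i => exact hζ i a b hd
  | fix ρ ih =>
    refine hd _ ⟨D.isSubdomain_amb_not_isAmb, ?_⟩ a b rfl
    rintro d hd a b rfl
    refine ih h (fun i => ?_) hd hdet
    refine Fin.cases ?_ (fun i => ?_) i
    · exact fun a b h => h a b rfl
    · exact hζ i
  | am ρ =>
    rcases hd with ⟨a', ha, b', hb, e⟩ | e
    · obtain ⟨rfl, rfl⟩ := D.amb_inj e
      exact ⟨Determined.not_isAmb h ha, Determined.not_isAmb h hb⟩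
    · exact absurd e (D.amb_ne_bot a b)
  | _ => exact absurd trivial hdet

end Ty

/-- If a program of regular type denotes `Amb(a,b)`, then neither `a` nor `b` is of this form. -/
theorem Prog.HasRegularType.not_isAmb {M : Prog 0} (hM : M.HasRegularType) {a b : D}
    (h : M.val = D.amb a b) : ¬ a.IsAmb ∧ ¬ b.IsAmb := by
  obtain ⟨ρ, hρ, ht | hv⟩ := hM
  · have := ht.rel_den (η := Fin.elim0) fun i => i.elim0
    rw [← val, h] at this
    exact Ty.not_isAmb_of_rel_amb hρ this
  · rw [h] at hv
    exact hρ.amDetermined.not_isAmb (fun i => i.elim0) hv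

namespace Prog

/-! ### Fair computations -/

open Classical in
/-- A reduction step that in `Amb` terms reduces the left or the right side as the flag `b` says. -/
noncomputable def fairNext (b : Bool) : {n : ℕ} → Prog n → Prog n
  | _, nil => nil
  | _, lam M => lam M
  | _, left M => left (fairNext b M)
  | _, right M => right (fairNext b M)
  | _, pair M N => pair (fairNext b M) (fairNext b N)
  | _, amb L R =>
    if L.Whnf then L else if R.Whnf then R else if b then amb L.next R else amb L R.next
  | _, M => M.next

theorem pStep_fairNext (b : Bool) : (M : Prog 0) → PStep M (fairNext b M)
  | nil => .nil
  | lam M => .lam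
  | left M => .left (pStep_fairNext b M)
  | right M => .right (pStep_fairNext b M)
  | pair M N => .pair (pStep_fairNext b M) (pStep_fairNext b N)
  | amb L R => by
    rw [fairNext]
    refine .cstep ?_
    split_ifs with hL hR hb
    · exact .chooseLeft hL
    · exact .chooseRight hR
    · exact .ambLeft (step_next L hL)
    · exact .ambRight (step_next R hR)
  | app M N => .cstep (.step (step_next _ (by simp)))
  | sapp M N => .cstep (.step (step_next _ (by simp)))
  | fixp M => .cstep (.step (step_next _ (by simp)))
  | bot => .cstep (.step (step_next _ (by simp)))
  | caseSum M L R => .cstep (.step (step_next _ (by simp)))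
  | casePair M N => .cstep (.step (step_next _ (by simp)))
  | caseAmb M N => .cstep (.step (step_next _ (by simp)))
termination_by M => sizeOf M

theorem amb_ne_left (M N : Prog 0) : amb M N ≠ M := fun h => by
  have := congrArg sizeOf h
  simp at this
  omega

theorem amb_ne_right (M N : Prog 0) : amb M N ≠ N := fun h => by
  have := congrArg sizeOf h
  simp at this

/-- With this flag the strategy reduces the right side or makes a choice, and a choice cannot return
an `Amb` with the same right side. So a left reduction here is never a reduction of the left side
only. -/
theorem reducesRight_fairNext {M : Prog 0} (h : ReducesLeft M (fairNext false M)) :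
    ReducesRight M (fairNext false M) := by
  obtain ⟨L, L', R, rfl, h, hL⟩ := h
  rw [fairNext, if_neg hL.not_whnf] at h ⊢
  by_cases hR : R.Whnf
  · rw [if_pos hR] at h
    exact absurd h.symm (amb_ne_right _ _)
  · rw [if_neg hR, if_neg Bool.false_ne_true]
    exact ⟨L, R, _, rfl, rfl, step_next R hR⟩

theorem reducesLeft_fairNext {M : Prog 0} (h : ReducesRight M (fairNext true M)) :
    ReducesLeft M (fairNext true M) := by
  obtain ⟨L, R, R', rfl, h, hR⟩ := h
  rw [fairNext] at h ⊢
  by_cases hL : L.Whnf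
  · rw [if_pos hL] at h
    exact absurd h.symm (amb_ne_left _ _)
  · rw [if_neg hL, if_neg hR.not_whnf, if_pos rfl]
    exact ⟨L, _, R, rfl, rfl, step_next L hL⟩

/-- The flag of the `i`-th step. -/
def flag (i : ℕ) : Bool := i % 2 = 0

theorem not_unfair_of_fairNext {s : ℕ → Prog 0} {k : ℕ}
    (hs : ∀ i, s (i + 1) = fairNext (flag (i + k)) (s i)) : ¬ Unfair s := by
  intro h
  -- The offset `k` must vary, because passing to a tail shifts the parity of the flags.
  induction h generalizing k with
  | @ambLeft s h =>
    obtain ⟨i, hi⟩ : ∃ i, flag (i + k) = false := ⟨k + 1, by simp [flag]; omega⟩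
    have := h i
    rw [hs, hi] at this
    exact this.2 (reducesRight_fairNext this.1)
  | @ambRight s h =>
    obtain ⟨i, hi⟩ : ∃ i, flag (i + k) = true := ⟨k, by simp [flag]; omega⟩
    have := h i
    rw [hs, hi] at this
    exact this.2 (reducesLeft_fairNext this.1)
  | @left s t h _ ih =>
    refine ih (k := k) fun i => ?_
    have := hs i
    rw [h, h, fairNext] at this
    exact Prog.left.inj this
  | @right s t h _ ih =>
    refine ih (k := k) fun i => ?_
    have := hs i
    rw [h, h, fairNext] at this
    exact Prog.right.inj this
  | @pairFst s t u h _ ih =>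
    refine ih (k := k) fun i => ?_
    have := hs i
    rw [h, h, fairNext] at this
    exact (Prog.pair.inj this).1
  | @pairSnd s t u h _ ih =>
    refine ih (k := k) fun i => ?_
    have := hs i
    rw [h, h, fairNext] at this
    exact (Prog.pair.inj this).2
  | @tail s _ ih =>
    refine ih (k := k + 1) fun i => ?_
    have := hs (i + 1)
    rwa [show i + 1 + k = i + (k + 1) by omega] at this

/-- Every closed program has a computation. -/
theorem exists_isComputation (M : Prog 0) : ∃ s, M.IsComputation s := by
  let s : ℕ → Prog 0 := fun i => Nat.rec M (fun i N => fairNext (flag i) N) i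
  exact ⟨s, rfl, fun i => pStep_fairNext _ _, not_unfair_of_fairNext (k := 0) fun i => rfl⟩

/-! ### Productivity -/

theorem PStep.step_of_not_whnf {M N : Prog 0} (h : PStep M N) (hM : ¬ M.Whnf) : Step M N := by
  cases h with
  | cstep h =>
    cases h with
    | step h => exact h
    | _ => simp at hM
  | _ => simp at hM

theorem PStep.cStep_of_amb {L R N : Prog 0} (h : PStep (amb L R) N) :
    ReducesLeft (amb L R) N ∨ ReducesRight (amb L R) N ∨ (L.Whnf ∧ N = L) ∨ (R.Whnf ∧ N = R) := by
  cases h with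
  | cstep h =>
    cases h with
    | step h => exact absurd (whnf_amb L R) h.not_whnf
    | ambLeft h => exact .inl ⟨_, _, _, rfl, rfl, h⟩
    | ambRight h => exact .inr (.inl ⟨_, _, _, rfl, rfl, h⟩)
    | chooseLeft h => exact .inr (.inr (.inl ⟨h, rfl⟩))
    | chooseRight h => exact .inr (.inr (.inr ⟨h, rfl⟩))

theorem val_amb (L R : Prog 0) : (amb L R).val = D.amb L.val R.val := rfl

theorem DWhnf.val_ne {M : Prog 0} (h : M.DWhnf) :
    M.val ≠ D.bot ∧ M.val ≠ D.amb D.bot D.bot := by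
  refine ⟨h.1.den_ne_bot _, fun e => ?_⟩
  have e' : (M.den Fin.elim0).unfold = .amb D.bot D.bot := by rw [← val, e, D.unfold_amb]
  obtain ⟨hw, hn⟩ := h
  cases M with
  | amb L R => exact hn ⟨L, R, rfl⟩
  | lam M =>
    rw [den_lam, D.unfold_fold] at e'
    cases e'
  | _ => first
    | (simp at hw; done)
    | simp [den] at e'

/-- Reduction steps cannot make a program productive that denotes `⊥` or `Amb(⊥,⊥)`. -/
theorem PStep.val_eq_bot_or {M N : Prog 0} (h : PStep M N)
    (hM : M.val = D.bot ∨ M.val = D.amb D.bot D.bot) :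
    N.val = D.bot ∨ N.val = D.amb D.bot D.bot := by
  by_cases hw : M.Whnf
  · by_cases ha : ∃ L R, M = amb L R
    · obtain ⟨L, R, rfl⟩ := ha
      have hLR := D.amb_inj (hM.resolve_left (hw.den_ne_bot _))
      rcases h.cStep_of_amb with ⟨_, L', _, e, rfl, hL⟩ | ⟨_, _, R', e, rfl, hR⟩ | ⟨h, rfl⟩ | ⟨h, rfl⟩
      · obtain ⟨rfl, rfl⟩ := Prog.amb.inj e
        rw [val_amb, ← hL.val_eq]
        exact hM
      · obtain ⟨rfl, rfl⟩ := Prog.amb.inj e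
        rw [val_amb, ← hR.val_eq]
        exact hM
      -- A side chosen from a program denoting `Amb(⊥,⊥)` denotes `⊥`.
      · exact .inl hLR.1
      · exact .inl hLR.2
    · have := DWhnf.val_ne ⟨hw, ha⟩
      exact hM.elim (fun h => absurd h this.1) fun h => absurd h this.2
  · rwa [← (h.step_of_not_whnf hw).val_eq]

theorem Unfair.of_shift {s : ℕ → Prog 0} (k : ℕ) (h : Unfair fun i => s (i + k)) : Unfair s := by
  induction k with
  | zero => exact h
  | succ k ih =>
    refine ih (.tail ?_)
    simpa only [Nat.add_right_comm, Nat.add_assoc, Nat.add_comm 1] using h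

theorem not_unfair_shift {s : ℕ → Prog 0} (k : ℕ) (h : ¬ Unfair s) :
    ¬ Unfair fun i => s (i + k) := fun h' => h (h'.of_shift k)

theorem IsComputation.shift {M : Prog 0} {s : ℕ → Prog 0} (h : IsComputation M s) (k : ℕ) :
    IsComputation (s k) fun i => s (i + k) :=
  ⟨by simp, fun i => by simpa only [Nat.add_right_comm] using h.2.1 (i + k),
    not_unfair_shift k h.2.2⟩

/-- A computation from a program that does not denote `⊥` reaches a weak head normal form. -/
theorem IsComputation.exists_whnf {M : Prog 0} (hM : M.val ≠ D.bot) {s : ℕ → Prog 0}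
    (hs : M.IsComputation s) : ∃ i, (s i).Whnf ∧ (s i).val = M.val := by
  induction acc_step hM generalizing s with
  | intro M _ ih =>
    by_cases hw : M.Whnf
    · exact ⟨0, by rwa [hs.1], by rw [hs.1]⟩
    · have h₁ := hs.2.1 0
      rw [hs.1] at h₁
      have hstep := h₁.step_of_not_whnf hw
      obtain ⟨i, hi, hv⟩ := ih _ hstep (by rwa [← hstep.val_eq]) (hs.shift 1)
      exact ⟨i + 1, hi, hv.trans hstep.val_eq.symm⟩

/-- The sequence describes one side of an `Amb` term, which rests while the other side is reduced.
By termination it moves only finitely often: the induction restarts after its first step. -/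
theorem exists_forall_not_step {l : ℕ → Prog 0} (hl : (l 0).val ≠ D.bot)
    (h : ∀ i, Step (l i) (l (i + 1)) ∨ l (i + 1) = l i) :
    ∃ N, ∀ i ≥ N, ¬ Step (l i) (l (i + 1)) := by
  have hacc := acc_step hl
  clear hl
  generalize hL : l 0 = L at hacc
  induction hacc generalizing l with
  | intro L _ ih =>
    by_cases hex : ∃ i, Step (l i) (l (i + 1))
    · classical
      have hconst : ∀ i ≤ Nat.find hex, l i = L := by
        intro i
        induction i with
        | zero => exact fun _ => hL
        | succ i ihi =>
          intro hi
          rw [(h i).resolve_left (Nat.find_min hex hi), ihi (by omega)]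
      have hstep := Nat.find_spec hex
      rw [hconst _ le_rfl] at hstep
      obtain ⟨N, hN⟩ := ih _ hstep (l := fun i => l (i + (Nat.find hex + 1)))
        (fun i => by simpa only [Nat.add_right_comm] using h (i + (Nat.find hex + 1))) (by simp)
      refine ⟨N + (Nat.find hex + 1), fun i hi => ?_⟩
      have := hN (i - (Nat.find hex + 1)) (by omega)
      rwa [Nat.add_right_comm, Nat.sub_add_cancel (by omega)] at this
    · exact ⟨0, fun i _ => not_exists.1 hex i⟩

/-- A fair reduction of an `Amb` term makes a choice if one side does not denote `⊥`, and the
result is a deterministic weak head normal form if no side denotes another `Amb`. -/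
theorem IsComputation.exists_dWhnf_of_amb {L R : Prog 0} {s : ℕ → Prog 0}
    (hs : (amb L R).IsComputation s) (hLR : L.val ≠ D.bot ∨ R.val ≠ D.bot)
    (hL : ¬ L.val.IsAmb) (hR : ¬ R.val.IsAmb) : ∃ i, (s i).DWhnf := by
  by_contra hno
  have dwhnf : ∀ {N : Prog 0}, N.Whnf → ¬ N.val.IsAmb → N.DWhnf :=
    fun h h' => ⟨h, by rintro ⟨A, B, rfl⟩; exact h' ⟨_, _, val_amb A B⟩⟩
  -- A choice would yield a weak head normal form with the value of `L` or `R`, hence a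
  -- deterministic one; so under the assumption `hno` no choice is ever made.
  have next : ∀ i L' R', s i = amb L' R' → L'.val = L.val → R'.val = R.val →
      ReducesLeft (s i) (s (i + 1)) ∨ ReducesRight (s i) (s (i + 1)) := by
    intro i L' R' hi hL' hR'
    have h := hs.2.1 i
    rw [hi] at h ⊢
    rcases h.cStep_of_amb with h | h | ⟨h, e⟩ | ⟨h, e⟩
    · exact .inl h
    · exact .inr h
    · exact absurd ⟨i + 1, e ▸ dwhnf h (hL' ▸ hL)⟩ hno
    · exact absurd ⟨i + 1, e ▸ dwhnf h (hR' ▸ hR)⟩ hno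
  have key : ∀ i, ∃ L' R', s i = amb L' R' ∧ L'.val = L.val ∧ R'.val = R.val := by
    intro i
    induction i with
    | zero => exact ⟨L, R, hs.1, rfl, rfl⟩
    | succ i ih =>
      obtain ⟨L', R', hi, hL', hR'⟩ := ih
      rcases next i L' R' hi hL' hR' with ⟨_, L₁, _, e, e', h⟩ | ⟨_, _, R₁, e, e', h⟩
      · obtain ⟨rfl, rfl⟩ := Prog.amb.inj (hi.symm.trans e)
        exact ⟨L₁, _, e', h.val_eq ▸ hL', hR'⟩
      · obtain ⟨rfl, rfl⟩ := Prog.amb.inj (hi.symm.trans e)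
        exact ⟨_, R₁, e', hL', h.val_eq ▸ hR'⟩
  choose l r hlr hl hr using key
  replace next := fun i => next i (l i) (r i) (hlr i) (hl i) (hr i)
  have hleft : ∀ i, ReducesLeft (s i) (s (i + 1)) → Step (l i) (l (i + 1)) ∧ r (i + 1) = r i := by
    rintro i ⟨_, L₁, _, e, e', h⟩
    obtain ⟨rfl, rfl⟩ := Prog.amb.inj ((hlr i).symm.trans e)
    obtain ⟨h₁, h₂⟩ := Prog.amb.inj ((hlr (i + 1)).symm.trans e')
    rw [h₁]
    exact ⟨h, h₂⟩
  have hright : ∀ i, ReducesRight (s i) (s (i + 1)) →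
      Step (r i) (r (i + 1)) ∧ l (i + 1) = l i := by
    rintro i ⟨_, _, R₁, e, e', h⟩
    obtain ⟨rfl, rfl⟩ := Prog.amb.inj ((hlr i).symm.trans e)
    obtain ⟨h₁, h₂⟩ := Prog.amb.inj ((hlr (i + 1)).symm.trans e')
    rw [h₂]
    exact ⟨h, h₁⟩
  rcases hLR with h | h
  -- From `N` on the left side is never reduced, so all steps reduce the right side only,
  -- contradicting fairness.
  · obtain ⟨N, hN⟩ := exists_forall_not_step (l := l) (by rwa [hl]) fun i =>
      (next i).imp (fun h => (hleft i h).1) fun h => (hright i h).2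
    have hnot : ∀ i ≥ N, ¬ ReducesLeft (s i) (s (i + 1)) := fun i hi h => hN i hi (hleft i h).1
    refine not_unfair_shift N hs.2.2 (.ambRight fun i => ?_)
    rw [Nat.add_right_comm]
    exact ⟨(next _).resolve_left (hnot _ (by omega)), hnot _ (by omega)⟩
  · obtain ⟨N, hN⟩ := exists_forall_not_step (l := r) (by rwa [hr]) fun i =>
      (next i).symm.imp (fun h => (hright i h).1) fun h => (hleft i h).2
    have hnot : ∀ i ≥ N, ¬ ReducesRight (s i) (s (i + 1)) := fun i hi h => hN i hi (hright i h).1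
    refine not_unfair_shift N hs.2.2 (.ambLeft fun i => ?_)
    rw [Nat.add_right_comm]
    exact ⟨(next _).resolve_right (hnot _ (by omega)), hnot _ (by omega)⟩

theorem HasRegularType.productive {M : Prog 0} (hM : M.HasRegularType) (h₁ : M.val ≠ D.bot)
    (h₂ : M.val ≠ D.amb D.bot D.bot) : M.Productive := by
  intro s hs
  obtain ⟨i, hw, hv⟩ := hs.exists_whnf h₁
  by_cases ha : ∃ L R, s i = amb L R
  · obtain ⟨L, R, e⟩ := ha
    rw [e, val_amb] at hv
    obtain ⟨hL, hR⟩ := hM.not_isAmb hv.symm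
    have hs' := hs.shift i
    rw [e] at hs'
    obtain ⟨j, hj⟩ := hs'.exists_dWhnf_of_amb (by
      by_contra! h
      rw [h.1, h.2] at hv
      exact h₂ hv.symm) hL hR
    exact ⟨_, hj⟩
  · exact ⟨i, hw, ha⟩

/-- Denoting `⊥` or `Amb(⊥,⊥)` is an invariant of reduction that no deterministic weak head normal
form satisfies. Fairness plays no role. -/
theorem IsComputation.val_ne {M : Prog 0} {s : ℕ → Prog 0} (hs : M.IsComputation s) {i : ℕ}
    (hi : (s i).DWhnf) : M.val ≠ D.bot ∧ M.val ≠ D.amb D.bot D.bot := by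
  by_contra h
  have key : ∀ i, (s i).val = D.bot ∨ (s i).val = D.amb D.bot D.bot := by
    intro i
    induction i with
    | zero =>
      rw [hs.1]
      tauto
    | succ i ih => exact (hs.2.1 i).val_eq_bot_or ih
  have := hi.val_ne
  exact (key i).elim this.1 this.2

end Prog

end AmbCalc

theorem corollary3p3 (M : AmbCalc.Prog 0) (hM : M.HasRegularType) :
    List.TFAE
      [M.Productive,
        ∃ s, M.IsComputation s ∧ ∃ i, (s i).DWhnf,
        M.val ≠ AmbCalc.D.bot ∧ M.val ≠ AmbCalc.D.amb AmbCalc.D.bot AmbCalc.D.bot] := by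
  tfae_have 1 → 2 := fun h =>
    have ⟨s, hs⟩ := M.exists_isComputation
    ⟨s, hs, h s hs⟩
  tfae_have 2 → 3 := fun ⟨s, hs, i, hi⟩ => hs.val_ne hi
  tfae_have 3 → 1 := fun h => hM.productive h.1 h.2
  tfae_finish
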